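/- **Notation.** Let $x=r\cos\theta$, $y=r\sin\theta$. All polynomials in $x,y$ have complex coefficients. Put $\nabla p=(\partial_x p,\partial_y p)^\top$ and $\operatorname{curl}(f_1,f_2)^\top=\partial_x f_2-\partial_y f_1$. Let $P_n^{(a,b)}$ be the Jacobi polynomials. For $m\in\mathbb Z$, $j\ge 0$ let $$y_m=(x+i\,\mathrm{sign}(m)\,y)^{|m|}=r^{|m|}e^{im\theta},\quad z^{(a)}_{mj}=P_j^{(a,|m|)}(2r^2-1)\,y_m,\quad z_{mj}=z^{(0)}_{mj},\quad w_{mj}=(1-r^2)z^{(1)}_{mj}.$$ For $n,b\ge 0$ let $\mathfrak r_n^{(b)}=10n^2+n(13b+19)+4(b+1)(b+2)$, $$\mathbf v_n^{(b)}(t)=\begin{pmatrix}(b+1)(1-t)P_n^{(1,b+1)}(2t-1)-2t(n+1)P_n^{(0,b+2)}(2t-1)\\(b+1)P_n^{(1,b+1)}(2t-1)\end{pmatrix},$$ $$\mathbf q_n^{(b),1}(t)=\frac{2n+b+1}{(n+1)\mathfrak r_n^{(b)}}\left[(2n+b+2)(2n+b+3)P_n^{(1,b)}(2t-1)\begin{pmatrix}1-t\\1\end{pmatrix}-(n+b+2)\mathbf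 v_n^{(b)}(t)\right],$$ and, for $n\ge1$, $\mathbf q_n^{(b),2}(t)=-\tfrac1n\mathbf v_{n-1}^{(b)}(t)-\mathbf q_n^{(b),1}(t)$. With $N(x,y)=\begin{pmatrix}1-y^2&xy\\xy&1-x^2\end{pmatrix}$ and the rotation matrix $\rho(\theta)$ let $$\mathbf n_{0j}^1=N\,P_{j-1}^{(0,1)}(2r^2-1)\begin{pmatrix}x\\y\end{pmatrix},\qquad \mathbf n_{0j}^2=N\,P_{j-1}^{(1,1)}(2r^2-1)\begin{pmatrix}-y\\x\end{pmatrix}\qquad(j\ge1),$$ $$\mathbf n_{mj}^\nu=N\,r^{|m|-1}e^{im\theta}\rho(\theta)\begin{pmatrix}1&0\\0&i\,\mathrm{sign}(m)\end{pmatrix}\mathbf q_j^{(|m|-1),\nu}(r^2)\qquad(m\neq0,\ j\ge0\text{ if }\nu=1,\ j\ge1\text{ if }\nu=2),$$ which are vector polynomials in $x,y$. Finally let $\mathbf n_{0j}^+=2\mathbf n_{0j}^1$ and $\mathbf n_{0j}^-=2\mathbf n_{0j}^2$ for $j\ge1$, and for $m\ne0$ let $\mathbf n_{m0}^-=2\mathbf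 n_{m0}^1$ and $\mathbf n_{mj}^\pm=\mathbf n_{mj}^1\pm\mathbf n_{mj}^2$ for $j\ge1$. Let $\mathcal V$ be the space of polynomials that vanish on the unit circle and $\mathcal N$ the space of vector polynomials $\mathbf f$ with $\mathbf f\cdot(-y,x)=0$ on the unit circle. The polynomial de Rham complex with boundary conditions on the disk is $0\to\mathcal V\xrightarrow{\nabla}\mathcal N\xrightarrow{\operatorname{curl}}\mathbb C[x,y]\to0$. **Theorem.** 1. For all $m\in\mathbb Z$ and $j\ge0$ the complex $$0\to\operatorname{span}\{w_{mj}\}\xrightarrow{\nabla}\operatorname{span}\{\mathbf n^+_{m,j+1},\mathbf n^-_{m,j+1}\}\xrightarrow{\operatorname{curl}}\operatorname{span}\{z_{m,j+1}\}\to0$$ is well defined and exact. 2. For all $m\ne0$ the complex $0\to0\to\operatorname{span}\{\mathbf n^-_{m0}\}\xrightarrow{\operatorname{curl}}\operatorname{span}\{z_{m0}\}\to0$ is well defined and exact. 3. The $w_{mj}$ ($m\in\mathbb Z$, $j\ge0$) form a basis of $\mathcal V$; the $\mathbf n_{mj}^+$ ($m\in\mathbb Z$, $j\ge1$) together with the $\mathbf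 n_{mj}^-$ ($m\in\mathbb Z$, $j\ge0$, $(m,j)\ne(0,0)$) form a basis of $\mathcal N$; the $z_{mj}$ ($m\in\mathbb Z$, $j\ge0$) form a basis of $\mathbb C[x,y]$. 4. The polynomial de Rham complex is the direct sum of the complexes in 1 (over all $m\in\mathbb Z$, $j\ge0$), those in 2 (over all $m\neq0$), and the complex $0\to0\to0\to\operatorname{span}\{z_{00}\}\to0$. 5. $\operatorname{span}\{z_{00}\}$ is the space of constants, and $\mathbb C[x,y]=\operatorname{curl}(\mathcal N)\oplus\operatorname{span}\{z_{00}\}$. -/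

import Mathlib

namespace DeRhamDisk

noncomputable section

open MvPolynomial

/-- Complex polynomials in the two real coordinates `x = X 0` and `y = X 1`. -/
abbrev Scal := MvPolynomial (Fin 2) ℂ

/-- Complex vector polynomials on the plane (columns of length two). -/
abbrev Vec := Fin 2 → Scal

/-- The polynomial `r ^ 2 = x ^ 2 + y ^ 2`. -/
def rsq : Scal := X 0 ^ 2 + X 1 ^ 2

/-- The gradient `p ↦ (∂ₓ p, ∂_y p)`. -/
def grad : Scal →ₗ[ℂ] Vec :=
  LinearMap.pi fun i => (pderiv i : Derivation ℂ Scal Scal).toLinearMap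

/-- The two-dimensional curl `f ↦ ∂ₓ f₂ - ∂_y f₁`. -/
def curl : Vec →ₗ[ℂ] Scal :=
  (pderiv 0 : Derivation ℂ Scal Scal).toLinearMap ∘ₗ LinearMap.proj 1 -
    (pderiv 1 : Derivation ℂ Scal Scal).toLinearMap ∘ₗ LinearMap.proj 0

/-- Scalar polynomials that vanish on the unit circle. -/
def vanishing : Submodule ℂ Scal where
  carrier := {p | ∀ x y : ℝ, x ^ 2 + y ^ 2 = 1 → eval ![(x : ℂ), (y : ℂ)] p = 0}
  zero_mem' := by intro x y _; simp
  add_mem' := by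
    intro p q hp hq x y h
    simp [hp x y h, hq x y h]
  smul_mem' := by
    intro c p hp x y h
    simp [smul_eval, hp x y h]

/-- Vector polynomials that are normal on the unit circle: `f · (-y, x) = 0` there. -/
def normal : Submodule ℂ Vec where
  carrier := {f | ∀ x y : ℝ, x ^ 2 + y ^ 2 = 1 →
    -(y : ℂ) * eval ![(x : ℂ), (y : ℂ)] (f 0) + (x : ℂ) * eval ![(x : ℂ), (y : ℂ)] (f 1) = 0}
  zero_mem' := by intro x y _; simp
  add_mem' := by
    intro p q hp hq x y h
    have h1 := hp x y h
    have h2 := hq x y h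
    simp only [Pi.add_apply, map_add]
    linear_combination h1 + h2
  smul_mem' := by
    intro c p hp x y h
    have h1 := hp x y h
    simp only [Pi.smul_apply, smul_eval]
    linear_combination c * h1

/-- The Jacobi polynomial `P_n^{(a,b)}` for natural parameters `a, b`:
`P_n^{(a,b)}(x) = ∑_{l ≤ n} C(n+a, l) C(n+b, n-l) ((x-1)/2)^(n-l) ((x+1)/2)^l`. -/
def jacobi (n a b : ℕ) : Polynomial ℂ :=
  ∑ l ∈ Finset.range (n + 1),
    Polynomial.C (((n + a).choose l * (n + b).choose (n - l) : ℕ) : ℂ) *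
      (Polynomial.C (1 / 2) * (Polynomial.X - 1)) ^ (n - l) *
      (Polynomial.C (1 / 2) * (Polynomial.X + 1)) ^ l

/-- The shifted Jacobi polynomial `t ↦ P_n^{(a,b)}(2t - 1)`. -/
def sjacobi (n a b : ℕ) : Polynomial ℂ :=
  (jacobi n a b).comp (2 * Polynomial.X - 1)

/-- The number `i sign m`. -/
def isgn (m : ℤ) : ℂ := Complex.I * (m.sign : ℂ)

/-- The harmonic polynomial `y_m = r^|m| e^{imθ} = (x + sign(m) i y)^|m|`. -/
def harm (m : ℤ) : Scal := (X 0 + C (isgn m) * X 1) ^ m.natAbs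

/-- The generalised Zernike polynomial `z_{mj}^{(a)} = P_j^{(a,|m|)}(2r² - 1) y_m`. -/
def zernikeGen (a : ℕ) (m : ℤ) (j : ℕ) : Scal :=
  Polynomial.aeval rsq (sjacobi j a m.natAbs) * harm m

/-- The Zernike polynomial `z_{mj} = z_{mj}^{(0)}`. -/
def zernike (m : ℤ) (j : ℕ) : Scal := zernikeGen 0 m j

/-- The weighted Zernike polynomial `w_{mj} = (1 - r²) z_{mj}^{(1)}`. -/
def wzernike (m : ℤ) (j : ℕ) : Scal := (1 - rsq) * zernikeGen 1 m j

/-- The constant `10 n² + n (13 b + 19) + 4 (b + 1) (b + 2)`. -/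
def rconst (n b : ℕ) : ℂ := 10 * n ^ 2 + n * (13 * b + 19) + 4 * (b + 1) * (b + 2)

/-- The auxiliary univariate vector polynomial `v_n^{(b)}(t)`. -/
def vaux (n b : ℕ) : Fin 2 → Polynomial ℂ :=
  ![((b : ℂ) + 1) • ((1 - Polynomial.X) * sjacobi n 1 (b + 1)) -
      (2 * ((n : ℂ) + 1)) • (Polynomial.X * sjacobi n 0 (b + 2)),
    ((b : ℂ) + 1) • sjacobi n 1 (b + 1)]

/-- The univariate vector polynomial `q_n^{(b),1}(t)`. -/
def q1 (n b : ℕ) : Fin 2 → Polynomial ℂ :=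
  ((2 * (n : ℂ) + b + 1) / (((n : ℂ) + 1) * rconst n b)) •
    (((2 * (n : ℂ) + b + 2) * (2 * (n : ℂ) + b + 3)) •
        ![sjacobi n 1 b * (1 - Polynomial.X), sjacobi n 1 b] -
      ((n : ℂ) + b + 2) • vaux n b)

/-- The univariate vector polynomial `q_n^{(b),2}(t) = -v_{n-1}^{(b)}(t) / n - q_n^{(b),1}(t)`,
`n ≥ 1`, with the convention `q_0^{(b),2} = 0`. -/
def q2 : ℕ → ℕ → Fin 2 → Polynomial ℂ
  | 0, _ => 0
  | n + 1, b => -((1 / ((n : ℂ) + 1)) • vaux n b) - q1 (n + 1) b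

/-- The equivariant matrix `Σ(x, y)`. -/
def sigmaMat : Matrix (Fin 2) (Fin 2) Scal :=
  !![X 0 ^ 2 - X 1 ^ 2, 2 * X 0 * X 1; 2 * X 0 * X 1, X 1 ^ 2 - X 0 ^ 2]

/-- The matrix weight `N(x, y)`, which annihilates the tangential direction on the unit circle. -/
def normalMat : Matrix (Fin 2) (Fin 2) Scal :=
  !![1 - X 1 ^ 2, X 0 * X 1; X 0 * X 1, 1 - X 0 ^ 2]

/-- The vector analogue of the harmonic polynomials for `m ≠ 0`:
`r^(|m|-1) e^{imθ} (e_r + i sign(m) e_θ) = (x + sign(m) i y)^(|m|-1) (1, i sign m)`. -/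
def vharm (m : ℤ) : Vec :=
  ((X 0 + C (isgn m) * X 1) ^ (m.natAbs - 1) : Scal) • (![1, C (isgn m)] : Vec)

/-- The map `𝒫_m`, `m ≠ 0`, from univariate vector polynomials `f(t) = (f₁(t), f₂(t))` with
`f₁(0) = f₂(0)` to vector polynomials on the plane of mode `m`. It is the linear map with
`tⁿ (1, 1) ↦ r^(2n) y_m` and, for `n ≥ 1`, `tⁿ (1, -1) ↦ r^(2n-2) Σ y_m`, where `y_m` is the
vector `vharm m`. In polar coordinates it is
`f ↦ r^(|m|-1) e^{imθ} ρ(θ) diag(1, i sign m) f(r²)`, see `pmap_polar`. -/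
def pmap (m : ℤ) (f : Fin 2 → Polynomial ℂ) : Vec :=
  Polynomial.aeval rsq (Polynomial.C (1 / 2) * (f 0 + f 1)) • vharm m +
    Polynomial.aeval rsq (Polynomial.divX (Polynomial.C (1 / 2) * (f 0 - f 1))) •
      (sigmaMat.mulVec (vharm m))

/-- The polar form of `pmap`: at `(r cos θ, r sin θ)` the value is
`r^(|m|-1) e^{imθ} ρ(θ) diag(1, i sign m) f(r²)`. -/
theorem pmap_polar (m : ℤ) (hm : m ≠ 0) (f : Fin 2 → Polynomial ℂ)
    (hf : (f 0).eval 0 = (f 1).eval 0) (r θ : ℝ) :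
    (fun i => eval ![((r * Real.cos θ : ℝ) : ℂ), ((r * Real.sin θ : ℝ) : ℂ)] (pmap m f i)) =
      ((r : ℂ) ^ (m.natAbs - 1) * Complex.exp (Complex.I * m * θ)) •
        (!![(Real.cos θ : ℂ), -(Real.sin θ : ℂ); (Real.sin θ : ℂ), (Real.cos θ : ℂ)] *
          !![1, 0; 0, isgn m]).mulVec
          ![(f 0).eval ((r : ℂ) ^ 2), (f 1).eval ((r : ℂ) ^ 2)] := by
  have hs : isgn m * isgn m = -1 := by
    rcases lt_or_gt_of_ne hm with h | h
    · simp [isgn, Int.sign_eq_neg_one_of_neg h]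
    · simp [isgn, Int.sign_eq_one_of_pos h]
  have hcs : (Real.cos θ : ℂ) ^ 2 + (Real.sin θ : ℂ) ^ 2 = 1 := by
    exact_mod_cast Real.cos_sq_add_sin_sq θ
  have hE : Complex.exp (Complex.I * m * θ) =
      ((Real.cos θ : ℂ) + isgn m * (Real.sin θ : ℂ)) ^ (m.natAbs - 1 + 1) := by
    have hk : m.natAbs - 1 + 1 = m.natAbs := by omega
    have h1 : (Real.cos θ : ℂ) + isgn m * (Real.sin θ : ℂ) =
        Complex.exp (isgn m * θ) := by
      rcases lt_or_gt_of_ne hm with h | h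
      · simp only [isgn, Int.sign_eq_neg_one_of_neg h, Complex.ofReal_cos, Complex.ofReal_sin]
        have := Complex.exp_mul_I (-(θ : ℂ))
        rw [Complex.cos_neg, Complex.sin_neg] at this
        push_cast
        rw [show Complex.I * -1 * (θ : ℂ) = -(θ : ℂ) * Complex.I by ring, this]
        ring
      · simp only [isgn, Int.sign_eq_one_of_pos h, Complex.ofReal_cos, Complex.ofReal_sin]
        have := Complex.exp_mul_I (θ : ℂ)
        push_cast
        rw [show Complex.I * 1 * (θ : ℂ) = (θ : ℂ) * Complex.I by ring, this]
        ring
    rw [hk, h1, ← Complex.exp_nat_mul]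
    congr 1
    have h2 : ((m.natAbs : ℤ) : ℂ) * ((m.sign : ℤ) : ℂ) = (m : ℂ) := by
      rw [← Int.cast_mul, mul_comm, Int.sign_mul_natAbs]
    rw [Int.cast_natCast] at h2
    rw [isgn, ← h2]
    ring
  set c : ℂ := (Real.cos θ : ℂ) with hc
  set d : ℂ := (Real.sin θ : ℂ) with hd
  have hpt : ![((r * Real.cos θ : ℝ) : ℂ), ((r * Real.sin θ : ℝ) : ℂ)] =
      ![(r : ℂ) * c, (r : ℂ) * d] := by
    rw [Complex.ofReal_mul, Complex.ofReal_mul]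
  have hev : ∀ p : Polynomial ℂ, eval ![(r : ℂ) * c, (r : ℂ) * d] (Polynomial.aeval rsq p) =
      p.eval ((r : ℂ) ^ 2) := by
    intro p
    have h1 : eval ![(r : ℂ) * c, (r : ℂ) * d] rsq = (r : ℂ) ^ 2 := by
      simp only [rsq, map_add, map_pow, eval_X, Matrix.cons_val_zero, Matrix.cons_val_one]
      linear_combination (r : ℂ) ^ 2 * hcs
    induction p using Polynomial.induction_on' with
    | add p q hp hq => simp only [map_add, hp, hq, Polynomial.eval_add]
    | monomial n a =>
      rw [Polynomial.aeval_monomial, map_mul, map_pow, h1, algebraMap_eq, eval_C,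
        Polynomial.eval_monomial]
  have hdiv : ((f 0 - f 1).divX).eval ((r : ℂ) ^ 2) * (r : ℂ) ^ 2 =
      (f 0).eval ((r : ℂ) ^ 2) - (f 1).eval ((r : ℂ) ^ 2) := by
    have h1 := congrArg (Polynomial.eval ((r : ℂ) ^ 2)) (Polynomial.divX_mul_X_add (f 0 - f 1))
    have h2 : (f 0 - f 1).coeff 0 = 0 := by
      rw [Polynomial.coeff_zero_eq_eval_zero, Polynomial.eval_sub, hf, sub_self]
    simpa [h2] using h1
  rw [hE, hpt, pow_succ (c + isgn m * d)]
  funext i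
  fin_cases i
  all_goals
    simp only [pmap, vharm, sigmaMat, Polynomial.divX_C_mul, Pi.add_apply, Pi.smul_apply,
      smul_eq_mul, map_add, map_mul, hev, Matrix.mulVec, dotProduct, Fin.sum_univ_two,
      Matrix.mul_apply, Fin.zero_eta, Fin.mk_one, Matrix.of_apply, Matrix.cons_val_zero,
      Matrix.cons_val_one, Matrix.cons_val', Matrix.cons_val_fin_one, map_pow, map_sub, eval_X,
      eval_C, map_ofNat, Polynomial.eval_C, mul_one, mul_zero, add_zero, zero_add]
    rw [show (r : ℂ) * c + isgn m * ((r : ℂ) * d) = r * (c + isgn m * d) by ring, mul_pow]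
    generalize ((f 0 - f 1).divX).eval ((r : ℂ) ^ 2) = D at *
    generalize (f 0).eval ((r : ℂ) ^ 2) = a at *
    generalize (f 1).eval ((r : ℂ) ^ 2) = b at *
    generalize isgn m = s at *
    generalize (c + s * d) ^ (m.natAbs - 1) = P at *
    generalize (r : ℂ) ^ (m.natAbs - 1) = R at *
  · linear_combination (1 / 2 * (c ^ 2 - d ^ 2 + 2 * c * d * s) * R * P) * hdiv -
      (R * P * (a + b) / 2) * hcs + (R * P * b * d ^ 2) * hs
  · linear_combination (1 / 2 * (2 * c * d + (d ^ 2 - c ^ 2) * s) * R * P) * hdiv -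
      (R * P * s * (a + b) / 2) * hcs - (R * P * b * c * d) * hs

/-- The vector orthogonal polynomials `v_{mj}^{N,1}`; for `m = 0` only `j ≥ 1` is meaningful. -/
def vN1 (m : ℤ) (j : ℕ) : Vec :=
  if m = 0 then Polynomial.aeval rsq (sjacobi (j - 1) 0 1) • ![X 0, X 1]
  else pmap m (q1 j (m.natAbs - 1))

/-- The vector orthogonal polynomials `v_{mj}^{N,2}`; only `j ≥ 1` is meaningful. -/
def vN2 (m : ℤ) (j : ℕ) : Vec :=
  if m = 0 then Polynomial.aeval rsq (sjacobi (j - 1) 1 1) • ![-X 1, X 0]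
  else pmap m (q2 j (m.natAbs - 1))

/-- `n_{mj}^1 = N v_{mj}^{N,1}`. -/
def n1 (m : ℤ) (j : ℕ) : Vec := normalMat.mulVec (vN1 m j)

/-- `n_{mj}^2 = N v_{mj}^{N,2}`. -/
def n2 (m : ℤ) (j : ℕ) : Vec := normalMat.mulVec (vN2 m j)

/-- `n_{mj}^+`, defined for `j ≥ 1`: `2 n_{0j}^1` for `m = 0`, and `n_{mj}^1 + n_{mj}^2` for
`m ≠ 0`. -/
def nPlus (m : ℤ) (j : ℕ) : Vec :=
  if m = 0 then (2 : ℂ) • n1 m j else n1 m j + n2 m j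

/-- `n_{mj}^-`, defined for `j ≥ 1` and, if `m ≠ 0`, also for `j = 0`: `2 n_{0j}^2` for `m = 0`,
`2 n_{m0}^1` for `m ≠ 0` and `j = 0`, and `n_{mj}^1 - n_{mj}^2` for `m ≠ 0` and `j ≥ 1`. -/
def nMinus (m : ℤ) (j : ℕ) : Vec :=
  if m = 0 then (2 : ℂ) • n2 m j
  else if j = 0 then (2 : ℂ) • n1 m j
  else n1 m j - n2 m j

/-- The sequence `0 → A → B → C → 0` of spaces of polynomials, with maps the restrictions of
`grad` and `curl`, is well defined and exact. -/
def IsExactSubcomplex (A : Submodule ℂ Scal) (B : Submodule ℂ Vec) (C : Submodule ℂ Scal) : Prop :=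
  ∃ (h₁ : ∀ u ∈ A, grad u ∈ B) (h₂ : ∀ f ∈ B, curl f ∈ C),
    Function.Injective (grad.restrict h₁) ∧
    Function.Exact (grad.restrict h₁) (curl.restrict h₂) ∧
    Function.Surjective (curl.restrict h₂)

/-- Labels of the sub-complexes: one for every mode `m` and `j ≥ 0`, an extra one for every
`m ≠ 0`, and the one formed by the constants. -/
inductive Piece : Type
  | main (m : ℤ) (j : ℕ) : Piece
  | extra (m : ℤ) (hm : m ≠ 0) : Piece
  | const : Piece

/-- The first space of each sub-complex. -/
def piece0 : Piece → Submodule ℂ Scal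
  | .main m j => Submodule.span ℂ {wzernike m j}
  | .extra _ _ => ⊥
  | .const => ⊥

/-- The second space of each sub-complex. -/
def piece1 : Piece → Submodule ℂ Vec
  | .main m j => Submodule.span ℂ {nPlus m (j + 1), nMinus m (j + 1)}
  | .extra m _ => Submodule.span ℂ {nMinus m 0}
  | .const => ⊥

/-- The third space of each sub-complex. -/
def piece2 : Piece → Submodule ℂ Scal
  | .main m j => Submodule.span ℂ {zernike m (j + 1)}
  | .extra m _ => Submodule.span ℂ {zernike m 0}
  | .const => Submodule.span ℂ {zernike 0 0}

/-- The family of all `n_{mj}^+` (`m ∈ ℤ`, `j ≥ 1`) and all `n_{mj}^-`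
(`m ∈ ℤ`, `j ≥ 0`, `(m, j) ≠ (0, 0)`). -/
def nFamily : (ℤ × ℕ) ⊕ {p : ℤ × ℕ // p ≠ (0, 0)} → Vec :=
  Sum.elim (fun p => nPlus p.1 (p.2 + 1)) (fun p => nMinus p.1.1 p.1.2)

end

end DeRhamDisk

/-!
By Leibniz' rule (Rodrigues' formula) differentiation maps `(1 - t) P_j^{(1,b)}(2t - 1)` to a
multiple of `P_j^{(0,b+1)}(2t - 1)`. In terms of the radial field, the tangential field and
`∇ y_m`, this makes `n_{m,j+1}^+` a nonzero multiple of `∇ w_{mj}` and `curl n_{mj}^-` a nonzero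
multiple of `z_{mj}`.

A polynomial is uniquely a sum of modes `p_m(r²) y_m`, and Jacobi polynomials have one member of
each degree, so the `z_{mj}^{(a)}` form a basis for every `a`. A polynomial vanishes on the circle
iff all its Fourier coefficients `p_m(1)` do, that is, iff it is a multiple of `1 - r²`.

The angular derivative `(-y, x) · ∇` multiplies the mode of index `m` by `i m`. Hence if `∇ p` is
normal on the circle, then `p` is constant there, and if `curl f` is constant for a normal `f`,
then `curl f = 0`. Together with the polynomial Poincaré lemma this shows that `∇ 𝒱` is the kernel
of `curl` on `𝒩` and that `curl 𝒩` meets the constants trivially. So the span of the `n_{mj}^±` has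
the same kernel and image under `curl` as `𝒩`, and is all of `𝒩`.
-/

namespace DeRhamDisk

noncomputable section

section Jacobi

open Polynomial

theorem map_half_mul_two {K R : Type*} [DivisionRing K] [NeZero (2 : K)] [Semiring R]
    (f : K →+* R) : f (1 / 2) * 2 = 1 := by
  rw [← map_ofNat f 2, ← map_mul, one_div_mul_cancel two_ne_zero, map_one]

theorem sjacobi_eq_sum (n a b : ℕ) :
    sjacobi n a b = ∑ l ∈ Finset.range (n + 1),
      ((n + a).choose l * (n + b).choose (n - l) : ℂ[X]) * ((X - 1) ^ (n - l) * X ^ l) := by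
  have sub_one : C (1 / 2 : ℂ) * (2 * X - 1 - 1) = X - 1 := by
    linear_combination (X - 1) * map_half_mul_two (C (R := ℂ))
  have add_one : C (1 / 2 : ℂ) * (2 * X - 1 + 1) = X := by
    linear_combination X * map_half_mul_two (C (R := ℂ))
  rw [sjacobi, jacobi, ← coe_compRingHom_apply, map_sum]
  refine Finset.sum_congr rfl fun l _ => ?_
  simp only [map_mul, map_pow, coe_compRingHom_apply, C_comp, sub_comp, add_comp, X_comp, one_comp,
    sub_one, add_one, map_natCast, Nat.cast_mul, mul_assoc]

/- Rodrigues' formula is Leibniz' rule: `C(n, l) (n + a)! (n + b)! / ((n + a - l)! (b + l)!)` is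
`n!` times the coefficient `C(n + a, l) C(n + b, n - l)`. -/
theorem iterate_derivative_sub_one_pow_mul_X_pow (n a b : ℕ) :
    derivative^[n] ((X - 1) ^ (n + a) * X ^ (n + b)) =
      (n.factorial : ℂ[X]) * ((X - 1) ^ a * X ^ b * sjacobi n a b) := by
  rw [sjacobi_eq_sum, iterate_derivative_mul, Finset.mul_sum, Finset.mul_sum,
    ← Finset.sum_range_reflect]
  refine Finset.sum_congr rfl fun l hl => ?_
  obtain ⟨k, rfl⟩ := Nat.exists_eq_add_of_le (Finset.mem_range_succ_iff.1 hl)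
  have coeff_eq : (l + k).choose k * (l + k + a).descFactorial l * (l + k + b).descFactorial k =
      (l + k).factorial * ((l + k + a).choose l * (l + k + b).choose k) := by
    rw [Nat.descFactorial_eq_factorial_mul_choose, Nat.descFactorial_eq_factorial_mul_choose,
      ← Nat.add_choose_mul_factorial_mul_factorial, ← Nat.choose_symm_add]
    ring
  have coeff_eq := congrArg (Nat.cast (R := ℂ[X])) coeff_eq
  rw [← C_1, Nat.succ_sub_one, Nat.add_sub_cancel_left, Nat.add_sub_cancel,
    iterate_derivative_X_sub_pow, iterate_derivative_X_pow_eq_natCast_mul,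
    show l + k + a - l = k + a by omega, show l + k + b - k = l + b by omega]
  push_cast [nsmul_eq_mul] at coeff_eq ⊢
  linear_combination (X - C 1) ^ (k + a) * X ^ (l + b) * coeff_eq

theorem derivative_X_pow_mul_X {R : Type*} [CommSemiring R] (k : ℕ) :
    derivative (X ^ k : R[X]) * X = (k : R[X]) * X ^ k := by
  cases k with
  | zero => simp
  | succ k => rw [derivative_X_pow, Nat.add_sub_cancel, map_natCast, mul_assoc, ← pow_succ]

theorem derivative_sub_one_pow_mul_X_pow_mul_sjacobi (n a b : ℕ) :
    derivative ((X - 1) ^ (a + 1) * X ^ (b + 1) * sjacobi n (a + 1) (b + 1)) =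
      (n + 1 : ℂ[X]) * ((X - 1) ^ a * X ^ b * sjacobi (n + 1) a b) := by
  have factorial_ne_zero : (n.factorial : ℂ[X]) ≠ 0 := by exact_mod_cast n.factorial_ne_zero
  apply mul_left_cancel₀ factorial_ne_zero
  have rodrigues_succ := iterate_derivative_sub_one_pow_mul_X_pow (n + 1) a b
  rw [Function.iterate_succ_apply', show n + 1 + a = n + (a + 1) by ring,
    show n + 1 + b = n + (b + 1) by ring, iterate_derivative_sub_one_pow_mul_X_pow,
    derivative_natCast_mul, Nat.factorial_succ] at rodrigues_succ
  rw [rodrigues_succ]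
  push_cast
  ring

/- Apply `D ^ n` to `X f' = (n + a + 1) (X - 1) ^ (n + a) X ^ (n + b + 1) + (n + b) f` with
`f = (X - 1) ^ (n + a + 1) X ^ (n + b)`. -/
theorem derivative_sub_one_pow_mul_sjacobi (n a b : ℕ) :
    derivative ((X - 1) ^ (a + 1) * sjacobi n (a + 1) b) =
      (n + a + 1 : ℂ[X]) * ((X - 1) ^ a * sjacobi n a (b + 1)) := by
  set g := (X - 1) ^ (a + 1) * sjacobi n (a + 1) b
  set f : ℂ[X] := (X - 1) ^ (n + (a + 1)) * X ^ (n + b) with hf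
  have iterate_f : derivative^[n] f = (n.factorial : ℂ[X]) * (X ^ b * g) := by
    rw [hf, iterate_derivative_sub_one_pow_mul_X_pow]
    ring
  have derivative_f_mul_X : derivative f * X =
      ((n + a + 1 : ℕ) : ℂ[X]) * ((X - 1) ^ (n + a) * X ^ (n + (b + 1))) +
        ((n + b : ℕ) : ℂ[X]) * f := by
    rw [hf, ← add_assoc n a 1, ← C_1, derivative_mul, derivative_X_sub_C_pow, add_mul,
      mul_assoc _ (derivative _), derivative_X_pow_mul_X, Nat.add_sub_cancel, map_natCast]
    ring
  have h := iterate_derivative_derivative_mul_X (n := n) f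
  rw [derivative_f_mul_X, iterate_map_add, iterate_derivative_natCast_mul,
    iterate_derivative_natCast_mul, iterate_derivative_sub_one_pow_mul_X_pow,
    Function.iterate_succ_apply', iterate_f, derivative_natCast_mul, derivative_mul] at h
  have factorial_ne_zero : (n.factorial : ℂ[X]) ≠ 0 := by exact_mod_cast n.factorial_ne_zero
  apply mul_left_cancel₀ (mul_ne_zero factorial_ne_zero (pow_ne_zero (b + 1) X_ne_zero))
  push_cast [nsmul_eq_mul] at h
  linear_combination -h - (n.factorial : ℂ[X]) * g * derivative_X_pow_mul_X (R := ℂ) b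

theorem degree_sjacobi (n a b : ℕ) : (sjacobi n a b).degree = n := by
  set f : ℂ[X] := (X - 1) ^ (n + a) * X ^ (n + b) with hf
  have monic_f : f.Monic := ((monic_X_sub_C (1 : ℂ)).pow _).mul (monic_X_pow _)
  have natDegree_f : f.natDegree = a + b + n + n := by
    rw [hf, ← C_1, ((monic_X_sub_C _).pow _).natDegree_mul (monic_X_pow _), natDegree_X_pow,
      natDegree_pow, natDegree_X_sub_C]
    ring
  have degree_iterate : (derivative^[n] f).degree = (a + b + n : ℕ) := by
    apply degree_eq_of_le_of_coeff_ne_zero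
    · exact degree_le_of_natDegree_le
        ((natDegree_iterate_derivative f n).trans_eq (by rw [natDegree_f, Nat.add_sub_cancel]))
    · rw [coeff_iterate_derivative, ← natDegree_f, monic_f.coeff_natDegree, nsmul_one,
        Nat.cast_ne_zero, natDegree_f]
      exact (Nat.descFactorial_pos.2 (Nat.le_add_left n _)).ne'
  rw [iterate_derivative_sub_one_pow_mul_X_pow, degree_mul, degree_mul, degree_mul, degree_pow,
    ← C_eq_natCast, degree_C (by exact_mod_cast n.factorial_ne_zero), ← C_1, degree_X_sub_C,
    degree_X_pow, nsmul_one, zero_add] at degree_iterate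
  exact (WithBot.add_left_inj (WithBot.coe_ne_bot (a := a + b))).1 degree_iterate

end Jacobi

section Calculus

open MvPolynomial

theorem pderiv_pderiv_comm {σ R : Type*} [CommSemiring R] (i j : σ) (p : MvPolynomial σ R) :
    pderiv i (pderiv j p) = pderiv j (pderiv i p) := by
  classical
  induction p using MvPolynomial.induction_on with
  | C a => simp only [pderiv_C, map_zero]
  | add p q hp hq => simp only [map_add, hp, hq]
  | mul_X p k hp =>
    have pderiv_pderiv_X (i j : σ) : pderiv i (pderiv j (X k : MvPolynomial σ R)) = 0 := by
      rw [pderiv_X, Pi.single_apply]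
      split_ifs
      · exact pderiv_one
      · exact map_zero _
    simp only [Derivation.leibniz, map_add, hp, pderiv_pderiv_X, smul_eq_mul]
    ring

theorem grad_apply (p : Scal) (i : Fin 2) : grad p i = pderiv i p := rfl

theorem curl_apply (f : Vec) : curl f = pderiv 0 (f 1) - pderiv 1 (f 0) := rfl

theorem curl_grad (p : Scal) : curl (grad p) = 0 := by
  rw [curl_apply, grad_apply, grad_apply, pderiv_pderiv_comm, sub_self]

theorem grad_mul (p q : Scal) : grad (p * q) = p • grad q + q • grad p := by
  funext i
  exact Derivation.leibniz (pderiv i) p q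

/-- The radial field `(x, y)`. -/
def radial : Vec := ![X 0, X 1]

/-- The field `(-y, x)`, which is tangent to the circles around the origin. -/
def tangent : Vec := ![-X 1, X 0]

theorem tangent_dotProduct (v : Vec) : tangent ⬝ᵥ v = X 0 * v 1 - X 1 * v 0 := by
  simp only [tangent, dotProduct, Fin.sum_univ_two, Matrix.cons_val_zero, Matrix.cons_val_one]
  ring

theorem radial_dotProduct (v : Vec) : radial ⬝ᵥ v = X 0 * v 0 + X 1 * v 1 := by
  simp only [radial, dotProduct, Fin.sum_univ_two, Matrix.cons_val_zero, Matrix.cons_val_one]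

theorem radial_dotProduct_radial : radial ⬝ᵥ radial = rsq := by
  rw [radial_dotProduct, rsq]
  simp only [radial, Matrix.cons_val_zero, Matrix.cons_val_one]
  ring

theorem tangent_dotProduct_tangent : tangent ⬝ᵥ tangent = rsq := by
  rw [tangent_dotProduct, rsq]
  simp only [tangent, Matrix.cons_val_zero, Matrix.cons_val_one]
  ring

theorem tangent_dotProduct_radial : tangent ⬝ᵥ radial = 0 := by
  rw [tangent_dotProduct]
  simp only [radial, Matrix.cons_val_zero, Matrix.cons_val_one]
  ring

theorem curl_smul (p : Scal) (v : Vec) :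
    curl (p • v) = p * curl v + (pderiv 0 p * v 1 - pderiv 1 p * v 0) := by
  simp only [curl_apply, Pi.smul_apply, smul_eq_mul, Derivation.leibniz]
  ring

theorem curl_tangent : curl tangent = 2 := by
  simp only [curl_apply, tangent, Matrix.cons_val_zero, Matrix.cons_val_one, map_neg, pderiv_X_self]
  norm_num

theorem grad_rsq : grad rsq = (2 : Scal) • radial := by
  funext i
  fin_cases i <;> simp [grad_apply, rsq, radial, pderiv_X]

theorem grad_aeval_rsq (p : Polynomial ℂ) :
    grad (Polynomial.aeval rsq p) = (2 * Polynomial.aeval rsq p.derivative) • radial := by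
  funext i
  rw [grad_apply, Derivation.map_aeval, ← grad_apply, grad_rsq]
  simp only [Pi.smul_apply, smul_eq_mul]
  ring

theorem curl_aeval_rsq_smul (p : Polynomial ℂ) (v : Vec) :
    curl (Polynomial.aeval rsq p • v) =
      Polynomial.aeval rsq p * curl v + 2 * Polynomial.aeval rsq p.derivative * tangent ⬝ᵥ v := by
  rw [curl_smul, ← grad_apply, ← grad_apply, grad_aeval_rsq, tangent_dotProduct]
  simp only [radial, Pi.smul_apply, smul_eq_mul, Matrix.cons_val_zero, Matrix.cons_val_one]
  ring

theorem normalMat_mulVec (v : Vec) :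
    normalMat.mulVec v = (1 - rsq) • v + (radial ⬝ᵥ v) • radial := by
  funext i
  rw [radial_dotProduct]
  fin_cases i <;>
  · simp only [normalMat, rsq, radial, Matrix.mulVec, dotProduct, Fin.sum_univ_two, Pi.add_apply,
      Pi.smul_apply, smul_eq_mul, Matrix.of_apply, Matrix.cons_val', Fin.zero_eta,
      Fin.mk_one, Matrix.cons_val_zero, Matrix.cons_val_one, Matrix.cons_val_fin_one]
    ring

theorem sigmaMat_mulVec (v : Vec) :
    sigmaMat.mulVec v = (2 * radial ⬝ᵥ v) • radial - rsq • v := by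
  funext i
  rw [radial_dotProduct]
  fin_cases i <;>
  · simp only [sigmaMat, rsq, radial, Matrix.mulVec, dotProduct, Fin.sum_univ_two, Pi.sub_apply,
      Pi.smul_apply, smul_eq_mul, Matrix.of_apply, Matrix.cons_val', Fin.zero_eta,
      Fin.mk_one, Matrix.cons_val_zero, Matrix.cons_val_one, Matrix.cons_val_fin_one]
    ring

theorem normalMat_mulVec_radial : normalMat.mulVec radial = radial := by
  rw [normalMat_mulVec, radial_dotProduct_radial, ← add_smul, sub_add_cancel, one_smul]

theorem normalMat_mulVec_tangent : normalMat.mulVec tangent = (1 - rsq) • tangent := by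
  rw [normalMat_mulVec, dotProduct_comm, tangent_dotProduct_radial, zero_smul, add_zero]

theorem mem_normal_iff {f : Vec} : f ∈ normal ↔ tangent ⬝ᵥ f ∈ vanishing := by
  refine forall₃_congr fun x y _ => ?_
  rw [tangent_dotProduct]
  simp only [map_sub, map_mul, eval_X, Matrix.cons_val_zero, Matrix.cons_val_one]
  rw [neg_mul, neg_add_eq_sub]

theorem one_sub_rsq_mul_mem_vanishing (p : Scal) : (1 - rsq) * p ∈ vanishing := by
  intro x y h
  have h : (x : ℂ) ^ 2 + (y : ℂ) ^ 2 = 1 := by exact_mod_cast h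
  simp [rsq, h]

theorem normalMat_mulVec_mem_normal (v : Vec) : normalMat.mulVec v ∈ normal := by
  rw [mem_normal_iff, normalMat_mulVec, dotProduct_add, dotProduct_smul, dotProduct_smul,
    tangent_dotProduct_radial, smul_zero, add_zero]
  exact one_sub_rsq_mul_mem_vanishing _

end Calculus

section Modes

open MvPolynomial

theorem isgn_mul_self {m : ℤ} (hm : m ≠ 0) : isgn m * isgn m = -1 := by
  rcases lt_or_gt_of_ne hm with h | h
  · simp [isgn, Int.sign_eq_neg_one_of_neg h]
  · simp [isgn, Int.sign_eq_one_of_pos h]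

theorem isgn_ne_zero {m : ℤ} (hm : m ≠ 0) : isgn m ≠ 0 :=
  mul_ne_zero Complex.I_ne_zero (Int.cast_ne_zero.2 (Int.sign_eq_zero_iff_zero.not.2 hm))

theorem C_isgn_mul_self {m : ℤ} (hm : m ≠ 0) : (C (isgn m) * C (isgn m) : Scal) = -1 := by
  rw [← C_mul, isgn_mul_self hm, C_neg, C_1]

theorem harm_zero : harm 0 = 1 := by rw [harm, Int.natAbs_zero, pow_zero]

theorem grad_harm (m : ℤ) : grad (harm m) = (m.natAbs : Scal) • vharm m := by
  funext i
  fin_cases i <;> simp [grad_apply, harm, vharm, pderiv_X]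

theorem curl_vharm (m : ℤ) : curl (vharm m) = 0 := by
  simp [curl_apply, vharm, pderiv_X, mul_comm, mul_left_comm]

theorem harm_eq_mul_pow {m : ℤ} (hm : m ≠ 0) :
    harm m = (X 0 + C (isgn m) * X 1) * (X 0 + C (isgn m) * X 1) ^ (m.natAbs - 1) :=
  (mul_pow_sub_one (Int.natAbs_ne_zero.2 hm) _).symm

theorem radial_dotProduct_vharm {m : ℤ} (hm : m ≠ 0) : radial ⬝ᵥ vharm m = harm m := by
  rw [radial_dotProduct, harm_eq_mul_pow hm]
  simp only [vharm, Pi.smul_apply, smul_eq_mul, Matrix.cons_val_zero, Matrix.cons_val_one]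
  ring

theorem tangent_dotProduct_vharm {m : ℤ} (hm : m ≠ 0) :
    tangent ⬝ᵥ vharm m = C (isgn m) * harm m := by
  rw [tangent_dotProduct, harm_eq_mul_pow hm]
  simp only [vharm, Pi.smul_apply, smul_eq_mul, Matrix.cons_val_zero, Matrix.cons_val_one]
  linear_combination (-X 1 * (X 0 + C (isgn m) * X 1) ^ (m.natAbs - 1)) * C_isgn_mul_self hm

theorem grad_aeval_rsq_mul_harm (m : ℤ) (p : Polynomial ℂ) :
    grad (Polynomial.aeval rsq p * harm m) =
      (2 * Polynomial.aeval rsq p.derivative * harm m) • radial +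
        (m.natAbs * Polynomial.aeval rsq p) • vharm m := by
  rw [grad_mul, grad_aeval_rsq, grad_harm]
  module

theorem curl_aeval_rsq_smul_vharm {m : ℤ} (hm : m ≠ 0) (p : Polynomial ℂ) :
    curl (Polynomial.aeval rsq p • vharm m) =
      (2 * isgn m) • (Polynomial.aeval rsq p.derivative * harm m) := by
  rw [curl_aeval_rsq_smul, curl_vharm, tangent_dotProduct_vharm hm, smul_eq_C_mul, C_mul,
    map_ofNat]
  ring

theorem pmap_add (m : ℤ) (f g : Fin 2 → Polynomial ℂ) : pmap m (f + g) = pmap m f + pmap m g := by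
  simp only [pmap, Pi.add_apply, add_sub_add_comm, mul_add, Polynomial.divX_add, map_add]
  module

theorem pmap_smul (m : ℤ) (c : ℂ) (f : Fin 2 → Polynomial ℂ) : pmap m (c • f) = c • pmap m f := by
  rw [pmap, pmap, smul_add, Pi.smul_apply, Pi.smul_apply, ← smul_add c, ← smul_sub]
  simp only [Polynomial.smul_eq_C_mul, mul_left_comm (Polynomial.C (1 / 2)) (Polynomial.C c),
    Polynomial.divX_C_mul, map_mul (Polynomial.aeval rsq) (Polynomial.C c), Polynomial.aeval_C,
    algebraMap_eq, ← smul_eq_C_mul, smul_assoc]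

/-- The linear map `f ↦ N 𝒫_m f`, which turns the univariate vector polynomials `q_j` into the
normal fields `n_{mj}`. -/
def normalPmap (m : ℤ) : (Fin 2 → Polynomial ℂ) →ₗ[ℂ] Vec where
  toFun f := normalMat.mulVec (pmap m f)
  map_add' f g := by rw [pmap_add, Matrix.mulVec_add]
  map_smul' c f := by rw [pmap_smul, Matrix.mulVec_smul, RingHom.id_apply]

theorem divX_mul_X {R : Type*} [Semiring R] (p : Polynomial R) :
    Polynomial.divX (p * Polynomial.X) = p := by
  ext n
  rw [Polynomial.coeff_divX, Polynomial.coeff_mul_X]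

/- Every `f` with `(f 0).eval 0 = (f 1).eval 0`, as required of the arguments of `pmap`, has this
form. -/
theorem normalPmap_apply {m : ℤ} (hm : m ≠ 0) (g h : Polynomial ℂ) :
    normalPmap m ![(1 - Polynomial.X) * g + 2 * Polynomial.X * h, g] =
      (2 * Polynomial.aeval rsq h * harm m) • radial +
        Polynomial.aeval rsq ((1 - Polynomial.X) * g) • vharm m := by
  have half_mul_two := map_half_mul_two (Polynomial.C (R := ℂ))
  have half_add : Polynomial.C (1 / 2 : ℂ) * ((1 - Polynomial.X) * g + 2 * Polynomial.X * h + g) =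
      g + Polynomial.X * (h - Polynomial.C (1 / 2) * g) := by
    linear_combination (g + Polynomial.X * h) * half_mul_two
  have half_sub : Polynomial.C (1 / 2 : ℂ) * ((1 - Polynomial.X) * g + 2 * Polynomial.X * h - g) =
      (h - Polynomial.C (1 / 2) * g) * Polynomial.X := by
    linear_combination (Polynomial.X * h) * half_mul_two
  have pmap_eq : pmap m ![(1 - Polynomial.X) * g + 2 * Polynomial.X * h, g] =
      Polynomial.aeval rsq g • vharm m + (Polynomial.aeval rsq (2 * h - g) * harm m) • radial := by
    have two_mul_half_sub : 2 * (h - Polynomial.C (1 / 2) * g) = 2 * h - g := by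
      linear_combination -g * half_mul_two
    rw [pmap, Matrix.cons_val_zero, Matrix.cons_val_one, Matrix.cons_val_fin_one, half_add,
      half_sub, divX_mul_X, sigmaMat_mulVec, radial_dotProduct_vharm hm, ← two_mul_half_sub]
    simp only [map_add, map_mul, map_ofNat, Polynomial.aeval_X]
    module
  change normalMat.mulVec _ = _
  rw [pmap_eq, Matrix.mulVec_add, Matrix.mulVec_smul, Matrix.mulVec_smul, normalMat_mulVec_radial,
    normalMat_mulVec, radial_dotProduct_vharm hm]
  simp only [map_sub, map_mul, map_ofNat, map_one, Polynomial.aeval_X]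
  module

end Modes

section Generators

open MvPolynomial

theorem derivative_one_sub_X_mul_sjacobi (n b : ℕ) :
    ((1 - Polynomial.X) * sjacobi n 1 b).derivative =
      -(n + 1 : Polynomial ℂ) * sjacobi n 0 (b + 1) := by
  have h := derivative_sub_one_pow_mul_sjacobi n 0 b
  rw [zero_add, pow_one, pow_zero, one_mul, Nat.cast_zero, add_zero] at h
  rw [← neg_sub, neg_mul, Polynomial.derivative_neg, h, neg_mul]

theorem wzernike_eq (m : ℤ) (j : ℕ) : wzernike m j =
    Polynomial.aeval rsq ((1 - Polynomial.X) * sjacobi j 1 m.natAbs) * harm m := by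
  rw [wzernike, zernikeGen, map_mul, map_sub, map_one, Polynomial.aeval_X, mul_assoc]

theorem grad_wzernike (m : ℤ) (j : ℕ) :
    grad (wzernike m j) =
      (-2 * (j + 1) * Polynomial.aeval rsq (sjacobi j 0 (m.natAbs + 1)) * harm m) • radial +
        (m.natAbs * Polynomial.aeval rsq ((1 - Polynomial.X) * sjacobi j 1 m.natAbs)) •
          vharm m := by
  rw [wzernike_eq, grad_aeval_rsq_mul_harm, derivative_one_sub_X_mul_sjacobi]
  simp only [map_mul, map_neg, map_add, map_natCast, map_one]
  module

theorem normalPmap_vaux {m : ℤ} (hm : m ≠ 0) (n : ℕ) :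
    normalPmap m (vaux n (m.natAbs - 1)) = grad (wzernike m n) := by
  obtain ⟨b, hb⟩ := Nat.exists_eq_succ_of_ne_zero (Int.natAbs_ne_zero.2 hm)
  have vaux_eq : vaux n b =
      ![(1 - Polynomial.X) * ((b + 1 : Polynomial ℂ) * sjacobi n 1 (b + 1)) +
        2 * Polynomial.X * (-(n + 1 : Polynomial ℂ) * sjacobi n 0 (b + 2)),
        (b + 1 : Polynomial ℂ) * sjacobi n 1 (b + 1)] := by
    simp only [vaux, Polynomial.smul_eq_C_mul, map_add, map_mul, map_natCast, map_one, map_ofNat]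
    congr 1
    ring
  rw [grad_wzernike, hb, Nat.succ_sub_one, vaux_eq, normalPmap_apply hm]
  simp only [map_sub, map_mul, map_neg, map_add, map_natCast, map_one]
  push_cast
  module

theorem nPlus_succ (m : ℤ) (j : ℕ) :
    nPlus m (j + 1) = (-(1 / ((j : ℂ) + 1))) • grad (wzernike m j) := by
  rcases eq_or_ne m 0 with rfl | hm
  · have n1_zero : n1 0 (j + 1) = Polynomial.aeval rsq (sjacobi j 0 1) • radial := by
      rw [n1, vN1, if_pos rfl, Matrix.mulVec_smul]
      exact congrArg _ normalMat_mulVec_radial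
    have grad_eq : grad (wzernike 0 j) =
        (-2 * ((j : ℂ) + 1)) • Polynomial.aeval rsq (sjacobi j 0 1) • radial := by
      rw [grad_wzernike, harm_zero, Int.natAbs_zero, Nat.cast_zero, zero_mul, zero_smul, add_zero,
        mul_one, ← smul_assoc, smul_eq_C_mul, C_mul, C_add, C_neg, C_1, map_ofNat, map_natCast]
    have := Nat.cast_add_one_ne_zero (R := ℂ) j
    have two_eq : (2 : ℂ) = -(1 / ((j : ℂ) + 1)) * (-2 * ((j : ℂ) + 1)) := by field_simp
    rw [nPlus, if_pos rfl, n1_zero, grad_eq, smul_smul, ← two_eq]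
  · rw [nPlus, if_neg hm, n1, n2, vN1, vN2, if_neg hm, if_neg hm, ← normalPmap_vaux hm,
      ← Matrix.mulVec_add, ← pmap_add, ← map_smul, q2, add_sub_cancel, neg_smul]
    rfl

theorem curl_nPlus_succ (m : ℤ) (j : ℕ) : curl (nPlus m (j + 1)) = 0 := by
  rw [nPlus_succ, map_smul, curl_grad, smul_zero]

theorem rconst_ne_zero (n b : ℕ) : rconst n b ≠ 0 := by
  rw [rconst]
  norm_cast

/-- The constant in `curl n_{mj}^- = curlCoeff m j • z_{mj}`, see `curl_nMinus`. -/
def curlCoeff (m : ℤ) (j : ℕ) : ℂ :=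
  if m = 0 then -4 * j
  else -4 * isgn m * ((2 * j + m.natAbs) * (2 * j + m.natAbs + 1) * (2 * j + m.natAbs + 2)) /
    rconst j (m.natAbs - 1)

theorem curlCoeff_ne_zero {m : ℤ} {j : ℕ} (h : (m, j) ≠ (0, 0)) : curlCoeff m j ≠ 0 := by
  rcases eq_or_ne m 0 with rfl | hm
  · have hj : j ≠ 0 := fun hj => h (by rw [hj])
    simp [curlCoeff, hj]
  · rw [curlCoeff, if_neg hm]
    refine div_ne_zero (mul_ne_zero (mul_ne_zero (by norm_num) (isgn_ne_zero hm)) ?_)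
      (rconst_ne_zero _ _)
    norm_cast
    positivity

theorem curl_n1 {m : ℤ} (hm : m ≠ 0) (j : ℕ) :
    (2 : ℂ) • curl (n1 m j) = curlCoeff m j • zernike m j := by
  obtain ⟨b, hb⟩ := Nat.exists_eq_succ_of_ne_zero (Int.natAbs_ne_zero.2 hm)
  have curl_normalPmap : curl (normalPmap m ![sjacobi j 1 b * (1 - Polynomial.X), sjacobi j 1 b]) =
      (-2 * isgn m * (j + 1)) • zernike m j := by
    have h := normalPmap_apply hm (sjacobi j 1 b) 0
    simp only [map_zero, mul_zero, zero_mul, zero_smul, zero_add, add_zero] at h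
    rw [mul_comm, h, curl_aeval_rsq_smul_vharm hm, derivative_one_sub_X_mul_sjacobi, zernike,
      zernikeGen, hb]
    simp only [map_mul, map_neg, map_add, map_natCast, map_one, smul_eq_C_mul, map_ofNat]
    ring
  have n1_eq : n1 m j = normalPmap m (q1 j (m.natAbs - 1)) := by rw [n1, vN1, if_neg hm]; rfl
  rw [n1_eq, q1]
  simp only [map_smul, map_sub]
  rw [normalPmap_vaux hm, curl_grad, smul_zero, sub_zero, hb, Nat.succ_sub_one, curl_normalPmap,
    curlCoeff, if_neg hm, hb, Nat.succ_sub_one, smul_smul, smul_smul, smul_smul]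
  have := rconst_ne_zero j b
  have := Nat.cast_add_one_ne_zero (R := ℂ) j
  congr 1
  push_cast
  field_simp
  ring

theorem curl_nMinus_zero_succ (j : ℕ) :
    curl (nMinus 0 (j + 1)) = curlCoeff 0 (j + 1) • zernike 0 (j + 1) := by
  set p := (1 - Polynomial.X) * sjacobi j 1 1 with hp
  have n2_zero : n2 0 (j + 1) = Polynomial.aeval rsq p • tangent := by
    rw [n2, vN2, if_pos rfl, Matrix.mulVec_smul]
    change _ • normalMat.mulVec tangent = _
    rw [normalMat_mulVec_tangent, smul_smul, hp, map_mul, map_sub, map_one, Polynomial.aeval_X,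
      mul_comm]
    rfl
  have derivative_mul_X : (p * Polynomial.X).derivative =
      -(j + 1 : Polynomial ℂ) * sjacobi (j + 1) 0 0 := by
    have h := derivative_sub_one_pow_mul_X_pow_mul_sjacobi j 0 0
    simp only [zero_add, pow_one, pow_zero, one_mul] at h
    rw [neg_mul, ← h, ← Polynomial.derivative_neg, hp]
    congr 1
    ring
  have aeval_derivative := congrArg (Polynomial.aeval rsq) derivative_mul_X
  simp only [Polynomial.derivative_mul, Polynomial.derivative_X, map_add, map_mul, map_neg,
    map_natCast, map_one, Polynomial.aeval_X, mul_one] at aeval_derivative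
  rw [nMinus, if_pos rfl, n2_zero, map_smul, curl_aeval_rsq_smul, curl_tangent,
    tangent_dotProduct_tangent, curlCoeff, if_pos rfl, zernike, zernikeGen, harm_zero, mul_one,
    Int.natAbs_zero]
  simp only [smul_eq_C_mul, map_mul, map_neg, map_ofNat, map_natCast]
  push_cast
  linear_combination 4 * aeval_derivative

theorem curl_nMinus {m : ℤ} {j : ℕ} (h : (m, j) ≠ (0, 0)) :
    curl (nMinus m j) = curlCoeff m j • zernike m j := by
  rcases eq_or_ne m 0 with rfl | hm
  · obtain ⟨j, rfl⟩ := Nat.exists_eq_succ_of_ne_zero (n := j) (fun hj => h (by rw [hj]))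
    exact curl_nMinus_zero_succ j
  rw [← curl_n1 hm]
  cases j with
  | zero => rw [nMinus, if_neg hm, if_pos rfl, map_smul]
  | succ j =>
    have curl_add := curl_nPlus_succ m j
    rw [nPlus, if_neg hm, map_add] at curl_add
    rw [nMinus, if_neg hm, if_neg j.succ_ne_zero, map_sub, eq_neg_of_add_eq_zero_right curl_add,
      sub_neg_eq_add, two_smul]

theorem nPlus_mem_normal (m : ℤ) (j : ℕ) : nPlus m j ∈ normal := by
  rw [nPlus, n1, n2]
  split_ifs
  · exact normal.smul_mem _ (normalMat_mulVec_mem_normal _)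
  · exact normal.add_mem (normalMat_mulVec_mem_normal _) (normalMat_mulVec_mem_normal _)

theorem nMinus_mem_normal (m : ℤ) (j : ℕ) : nMinus m j ∈ normal := by
  rw [nMinus, n1, n2]
  split_ifs
  · exact normal.smul_mem _ (normalMat_mulVec_mem_normal _)
  · exact normal.smul_mem _ (normalMat_mulVec_mem_normal _)
  · exact normal.sub_mem (normalMat_mulVec_mem_normal _) (normalMat_mulVec_mem_normal _)

end Generators

section Modal

open MvPolynomial Module

theorem C_half_mul_two : (C (1 / 2) * 2 : Scal) = 1 :=
  map_half_mul_two (C : ℂ →+* Scal)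

theorem C_I_mul_C_I : (C Complex.I * C Complex.I : Scal) = -1 := by
  rw [← C_mul, Complex.I_mul_I, C_neg, C_1]

/-- The substitution `x ↦ x + i y`, `y ↦ x - i y`, which turns monomials into modes. -/
def complexCoord : Scal ≃ₐ[ℂ] Scal :=
  AlgEquiv.ofAlgHom
    (aeval ![X 0 + C Complex.I * X 1, X 0 - C Complex.I * X 1])
    (aeval ![C (1 / 2) * (X 0 + X 1), -C (1 / 2) * C Complex.I * (X 0 - X 1)])
    (by
      ext i : 1
      fin_cases i <;>
        simp only [AlgHom.coe_comp, Function.comp_apply, aeval_X, Fin.zero_eta, Fin.mk_one,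
          Matrix.cons_val_zero, Matrix.cons_val_one, Matrix.cons_val_fin_one, map_add, map_sub,
          map_neg, map_mul, algHom_C, algebraMap_eq, AlgHom.coe_id, id_eq]
      · linear_combination X 0 * C_half_mul_two
      · linear_combination X 1 * C_half_mul_two - X 1 * C (1 / 2) * 2 * C_I_mul_C_I)
    (by
      ext i : 1
      fin_cases i <;>
        simp only [AlgHom.coe_comp, Function.comp_apply, aeval_X, Fin.zero_eta, Fin.mk_one,
          Matrix.cons_val_zero, Matrix.cons_val_one, Matrix.cons_val_fin_one, map_add, map_sub,
          map_mul, algHom_C, algebraMap_eq, AlgHom.coe_id, id_eq]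
      · linear_combination X 0 * C_half_mul_two - C (1 / 2) * (X 0 - X 1) * C_I_mul_C_I
      · linear_combination X 1 * C_half_mul_two + C (1 / 2) * (X 0 - X 1) * C_I_mul_C_I)

theorem rsq_eq : rsq = (X 0 + C Complex.I * X 1) * (X 0 - C Complex.I * X 1) := by
  rw [rsq]
  linear_combination X 1 ^ 2 * C_I_mul_C_I

theorem harm_eq (m : ℤ) : harm m =
    (X 0 + C Complex.I * X 1) ^ m.toNat * (X 0 - C Complex.I * X 1) ^ (-m).toNat := by
  rcases lt_trichotomy m 0 with hm | rfl | hm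
  · rw [harm, isgn, Int.sign_eq_neg_one_of_neg hm, Int.toNat_of_nonpos hm.le, pow_zero, one_mul,
      show m.natAbs = (-m).toNat by omega]
    simp [sub_eq_add_neg]
  · simp [harm]
  · rw [harm, isgn, Int.sign_eq_one_of_pos hm, Int.toNat_of_nonpos (neg_nonpos.2 hm.le), pow_zero,
      mul_one, show m.natAbs = m.toNat by omega]
    simp

/-- The exponents `(a, b)` of `(x + iy)^a (x - iy)^b = r^(2k) y_m` in terms of `m` and `k`. -/
def modeIndex : (Σ _ : ℤ, ℕ) ≃ (Fin 2 →₀ ℕ) :=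
  Equiv.trans
    { toFun := fun p => (p.2 + p.1.toNat, p.2 + (-p.1).toNat)
      invFun := fun q => ⟨(q.1 : ℤ) - q.2, min q.1 q.2⟩
      left_inv := by
        rintro ⟨m, k⟩
        refine Sigma.ext ?_ (heq_of_eq ?_) <;> simp only <;> omega
      right_inv := by
        rintro ⟨a, b⟩
        refine Prod.ext ?_ ?_ <;> simp only <;> omega }
    ((finTwoArrowEquiv ℕ).symm.trans Finsupp.equivFunOnFinite.symm)

/-- The basis `r^(2k) y_m` of the space of polynomials. -/
def modeBasis : Basis (Σ _ : ℤ, ℕ) ℂ Scal :=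
  ((basisMonomials (Fin 2) ℂ).map complexCoord.toLinearEquiv).reindex modeIndex.symm

theorem modeBasis_apply (m : ℤ) (k : ℕ) : modeBasis ⟨m, k⟩ = rsq ^ k * harm m := by
  have monomial_modeIndex : monomial (modeIndex ⟨m, k⟩) (1 : ℂ) =
      X 0 ^ (k + m.toNat) * X 1 ^ (k + (-m).toNat) := by
    rw [monomial_eq]
    simp [Finsupp.prod_fintype, Fin.prod_univ_two, modeIndex]
  have complexCoord_X (i : Fin 2) : complexCoord (X i) =
      ![X 0 + C Complex.I * X 1, X 0 - C Complex.I * X 1] i := aeval_X _ i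
  rw [modeBasis, Basis.reindex_apply, Basis.map_apply, coe_basisMonomials, Equiv.symm_symm]
  change complexCoord (monomial _ 1) = _
  rw [monomial_modeIndex, rsq_eq, harm_eq, map_mul, map_pow, map_pow, complexCoord_X,
    complexCoord_X, Matrix.cons_val_zero, Matrix.cons_val_one, Matrix.cons_val_fin_one, mul_pow]
  ring

/-- The decomposition of a polynomial into its modes `p_m(r²) y_m`. -/
def modeEquiv : (ℤ →₀ Polynomial ℂ) ≃ₗ[ℂ] Scal :=
  (Finsupp.basis fun _ => Polynomial.basisMonomials ℂ).equiv modeBasis (Equiv.refl _)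

theorem modeEquiv_single (m : ℤ) (p : Polynomial ℂ) :
    modeEquiv (Finsupp.single m p) = Polynomial.aeval rsq p * harm m := by
  suffices modeEquiv.toLinearMap ∘ₗ Finsupp.lsingle m =
      LinearMap.mulRight ℂ (harm m) ∘ₗ (Polynomial.aeval rsq).toLinearMap from
    LinearMap.congr_fun this p
  refine (Polynomial.basisMonomials ℂ).ext fun k => ?_
  have equiv_basis := (Finsupp.basis fun _ : ℤ => Polynomial.basisMonomials ℂ).equiv_apply ⟨m, k⟩
    modeBasis (Equiv.refl _)
  rw [Finsupp.coe_basis, Equiv.refl_apply, modeBasis_apply] at equiv_basis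
  simpa [modeEquiv] using equiv_basis

theorem modeEquiv_apply (f : ℤ →₀ Polynomial ℂ) :
    modeEquiv f = f.sum fun m p => Polynomial.aeval rsq p * harm m := by
  conv_lhs => rw [← f.sum_single, Finsupp.sum, map_sum]
  simp only [modeEquiv_single, Finsupp.sum]

/-- The shifted Jacobi polynomials, one for each degree. -/
def jacobiSequence (a b : ℕ) : Polynomial.Sequence ℂ where
  elems' n := sjacobi n a b
  degree_eq' n := degree_sjacobi n a b

/-- The generalised Zernike polynomials form a basis of the space of polynomials. -/
def zernikeGenBasis (a : ℕ) : Basis (ℤ × ℕ) ℂ Scal :=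
  ((Finsupp.basis fun m : ℤ => (jacobiSequence a m.natAbs).basis fun i =>
    (Polynomial.leadingCoeff_ne_zero.2 ((jacobiSequence a m.natAbs).ne_zero i)).isUnit).map
      modeEquiv).reindex (Equiv.sigmaEquivProd ℤ ℕ)

theorem zernikeGenBasis_apply (a : ℕ) (p : ℤ × ℕ) :
    zernikeGenBasis a p = zernikeGen a p.1 p.2 := by
  rw [zernikeGenBasis, Basis.reindex_apply, Basis.map_apply, Finsupp.coe_basis]
  simp only [Equiv.sigmaEquivProd_symm_apply, modeEquiv_single, Polynomial.Sequence.basis_eq_self]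
  rfl

end Modal

section Boundary

open MvPolynomial Module

/-- The `m`-th Fourier coefficient of the restriction of a polynomial to the unit circle, read off
from the mode of index `m`, as `p(r²) y_m` restricts to `p(1) e^{imθ}`. -/
def boundaryCoeff (m : ℤ) : Scal →ₗ[ℂ] ℂ :=
  Polynomial.leval 1 ∘ₗ Finsupp.lapply m ∘ₗ modeEquiv.symm.toLinearMap

theorem boundaryCoeff_modeEquiv (m : ℤ) (f : ℤ →₀ Polynomial ℂ) :
    boundaryCoeff m (modeEquiv f) = (f m).eval 1 := by
  simp [boundaryCoeff]

theorem boundaryCoeff_aeval_rsq_mul_harm (m n : ℤ) (p : Polynomial ℂ) :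
    boundaryCoeff m (Polynomial.aeval rsq p * harm n) = if n = m then p.eval 1 else 0 := by
  rw [← modeEquiv_single, boundaryCoeff_modeEquiv, Finsupp.single_apply]
  split_ifs <;> simp

theorem zpow_coeHom_injective :
    Function.Injective fun m : ℤ => Circle.coeHom.comp (zpowGroupHom m : Circle →* Circle) := by
  intro m n h
  by_contra hmn
  have sub_ne_zero : ((m - n : ℤ) : ℝ) ≠ 0 := by exact_mod_cast sub_ne_zero.2 hmn
  have zpow_eq : Circle.exp (Real.pi / (m - n : ℤ)) ^ m = Circle.exp (Real.pi / (m - n : ℤ)) ^ n :=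
    Circle.ext (DFunLike.congr_fun h _)
  refine Circle.exp_pi_ne_one ?_
  rw [← mul_div_cancel₀ Real.pi sub_ne_zero, Circle.exp_intCast_mul, zpow_sub, zpow_eq,
    mul_inv_cancel]

/-- The point `(x, y)` of the unit circle with `x + iy = z`, as a point of `ℂ²`. -/
def circlePoint (z : Circle) : Fin 2 → ℂ := ![((z : ℂ).re : ℂ), ((z : ℂ).im : ℂ)]

theorem mem_vanishing_iff_circlePoint {p : Scal} :
    p ∈ vanishing ↔ ∀ z : Circle, eval (circlePoint z) p = 0 := by
  refine ⟨fun h z => h _ _ ?_, fun h x y hxy => ?_⟩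
  · rw [sq, sq, ← Complex.normSq_apply, Circle.normSq_coe]
  · have norm_eq_one : ‖(⟨x, y⟩ : ℂ)‖ = 1 := by
      rw [Complex.norm_def, Complex.normSq_apply, Real.sqrt_eq_one, ← sq, ← sq, hxy]
    exact h ⟨⟨x, y⟩, mem_sphere_zero_iff_norm.2 norm_eq_one⟩

theorem eval_circlePoint_aeval_rsq_mul_harm (z : Circle) (p : Polynomial ℂ) (m : ℤ) :
    eval (circlePoint z) (Polynomial.aeval rsq p * harm m) =
      p.eval 1 * (z : ℂ) ^ m := by
  set ev := eval (circlePoint z) with hev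
  have eval_add : ev (X 0 + C Complex.I * X 1) = z := by
    simp only [hev, circlePoint, map_add, map_mul, eval_X, eval_C, Matrix.cons_val_zero,
      Matrix.cons_val_one, Matrix.cons_val_fin_one]
    rw [mul_comm, Complex.re_add_im]
  have eval_sub : ev (X 0 - C Complex.I * X 1) = (z : ℂ)⁻¹ := by
    rw [← Circle.coe_inv, Circle.coe_inv_eq_conj]
    simp only [hev, circlePoint, map_sub, map_mul, eval_X, eval_C, Matrix.cons_val_zero,
      Matrix.cons_val_one, Matrix.cons_val_fin_one]
    apply Complex.ext <;> simp
  have eval_rsq : ev rsq = 1 := by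
    rw [rsq_eq, map_mul, eval_add, eval_sub, mul_inv_cancel₀ z.coe_ne_zero]
  have eval_aeval : ev (Polynomial.aeval rsq p) = p.eval 1 := by
    rw [Polynomial.aeval_def, Polynomial.hom_eval₂, eval_rsq, algebraMap_eq,
      show ev.comp C = RingHom.id ℂ from RingHom.ext fun a => eval_C a, Polynomial.eval₂_id]
  have eval_harm : ev (harm m) = (z : ℂ) ^ m := by
    rw [harm_eq, map_mul, map_pow, map_pow, eval_add, eval_sub, inv_pow, ← zpow_natCast,
      ← zpow_natCast, ← zpow_neg, ← zpow_add₀ z.coe_ne_zero]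
    congr 1
    omega
  rw [map_mul, eval_aeval, eval_harm]

theorem eval_circlePoint_modeEquiv (z : Circle) (f : ℤ →₀ Polynomial ℂ) :
    eval (circlePoint z) (modeEquiv f) = f.sum fun m p => p.eval 1 * (z : ℂ) ^ m := by
  rw [modeEquiv_apply, Finsupp.sum, map_sum]
  simp only [eval_circlePoint_aeval_rsq_mul_harm, Finsupp.sum]

/- By Dedekind, the distinct characters `z ↦ z ^ m` of the circle are linearly independent. -/
theorem mem_vanishing_iff_boundaryCoeff {p : Scal} :
    p ∈ vanishing ↔ ∀ m, boundaryCoeff m p = 0 := by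
  obtain ⟨f, rfl⟩ := modeEquiv.surjective p
  simp only [mem_vanishing_iff_circlePoint, boundaryCoeff_modeEquiv,
    eval_circlePoint_modeEquiv]
  refine ⟨fun h => ?_, fun h z => Finset.sum_eq_zero fun m _ => by simp only [h, zero_mul]⟩
  have eval_eq_zero_of_mem : ∀ m ∈ f.support, (f m).eval 1 = 0 := by
    refine linearIndependent_iff'.1
      ((linearIndependent_monoidHom Circle ℂ).comp _ zpow_coeHom_injective) f.support _ ?_
    funext z
    rw [Finset.sum_apply]
    exact h z
  intro m
  by_cases hm : m ∈ f.support
  · exact eval_eq_zero_of_mem m hm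
  · rw [Finsupp.notMem_support_iff.1 hm, Polynomial.eval_zero]

theorem mem_vanishing_iff_dvd {p : Scal} : p ∈ vanishing ↔ 1 - rsq ∣ p := by
  refine ⟨fun hp => ?_, fun ⟨q, hq⟩ => hq ▸ one_sub_rsq_mul_mem_vanishing q⟩
  obtain ⟨f, rfl⟩ := modeEquiv.surjective p
  rw [modeEquiv_apply]
  refine Finset.dvd_sum fun m _ => Dvd.dvd.mul_right ?_ _
  have X_sub_one_dvd : Polynomial.X - Polynomial.C 1 ∣ f m := by
    rw [Polynomial.dvd_iff_isRoot, Polynomial.IsRoot, ← boundaryCoeff_modeEquiv]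
    exact mem_vanishing_iff_boundaryCoeff.1 hp m
  have rsq_sub_one_dvd := map_dvd (Polynomial.aeval rsq) X_sub_one_dvd
  rwa [map_sub, Polynomial.aeval_X, Polynomial.C_1, map_one, ← neg_sub, neg_dvd] at rsq_sub_one_dvd

theorem one_sub_rsq_ne_zero : 1 - rsq ≠ 0 := by
  intro h
  simpa [rsq] using congrArg (eval 0) h

theorem mulLeft_comp_zernikeGenBasis :
    LinearMap.mulLeft ℂ (1 - rsq) ∘ zernikeGenBasis 1 = fun p => wzernike p.1 p.2 := by
  funext p
  rw [Function.comp_apply, zernikeGenBasis_apply]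
  rfl

theorem linearIndependent_wzernike :
    LinearIndependent ℂ (fun p : ℤ × ℕ => wzernike p.1 p.2) := by
  rw [← mulLeft_comp_zernikeGenBasis]
  exact (zernikeGenBasis 1).linearIndependent.map' _
    (LinearMap.ker_eq_bot.2 (mul_right_injective₀ one_sub_rsq_ne_zero))

theorem span_wzernike :
    Submodule.span ℂ (Set.range fun p : ℤ × ℕ => wzernike p.1 p.2) = vanishing := by
  rw [← mulLeft_comp_zernikeGenBasis, Set.range_comp, ← Submodule.map_span,
    (zernikeGenBasis 1).span_eq, Submodule.map_top]
  ext p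
  rw [mem_vanishing_iff_dvd]
  exact exists_congr fun _ => eq_comm

theorem coe_zernikeGenBasis_zero : ⇑(zernikeGenBasis 0) = fun p => zernike p.1 p.2 :=
  funext (zernikeGenBasis_apply 0)

theorem linearIndependent_zernike : LinearIndependent ℂ (fun p : ℤ × ℕ => zernike p.1 p.2) :=
  coe_zernikeGenBasis_zero ▸ (zernikeGenBasis 0).linearIndependent

theorem span_zernike : Submodule.span ℂ (Set.range fun p : ℤ × ℕ => zernike p.1 p.2) = ⊤ :=
  coe_zernikeGenBasis_zero ▸ (zernikeGenBasis 0).span_eq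

end Boundary

section Exactness

open MvPolynomial Module

/-- The antiderivative with respect to `X i` that vanishes at `X i = 0`. In positive characteristic
the coefficients that would need a division by `0` are set to `0`. -/
def antideriv {σ K : Type*} [Field K] (i : σ) : MvPolynomial σ K →ₗ[K] MvPolynomial σ K :=
  (basisMonomials σ K).constr K fun s => monomial (s + Finsupp.single i 1) (1 / ((s i : K) + 1))

theorem antideriv_monomial {σ K : Type*} [Field K] (i : σ) (s : σ →₀ ℕ) (a : K) :
    antideriv i (monomial s a) = monomial (s + Finsupp.single i 1) (a / ((s i : K) + 1)) := by
  have monomial_eq_smul : monomial s a = a • basisMonomials σ K s := by simp [smul_monomial]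
  rw [monomial_eq_smul, map_smul, antideriv, Basis.constr_basis, smul_monomial, smul_eq_mul,
    mul_one_div]

theorem pderiv_antideriv {σ K : Type*} [Field K] [CharZero K] (i : σ) (p : MvPolynomial σ K) :
    pderiv i (antideriv i p) = p := by
  induction p using MvPolynomial.induction_on' with
  | monomial s a =>
    rw [antideriv_monomial, pderiv_monomial, add_tsub_cancel_right, Finsupp.add_apply,
      Finsupp.single_eq_same, Nat.cast_add_one, div_mul_cancel₀ _ (Nat.cast_add_one_ne_zero _)]
  | add p q hp hq => rw [map_add, map_add, hp, hq]

theorem pderiv_antideriv_comm {σ K : Type*} [Field K] {i j : σ} (hij : i ≠ j)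
    (p : MvPolynomial σ K) : pderiv j (antideriv i p) = antideriv i (pderiv j p) := by
  classical
  induction p using MvPolynomial.induction_on' with
  | monomial s a =>
    have tsub_add_comm : s + Finsupp.single i 1 - Finsupp.single j 1 =
        s - Finsupp.single j 1 + Finsupp.single i 1 := by
      ext k
      rcases eq_or_ne i k with rfl | hk
      · simp [hij.symm]
      · simp [Finsupp.single_apply, hk]
    rw [antideriv_monomial, pderiv_monomial, pderiv_monomial, antideriv_monomial, tsub_add_comm]
    simp [hij, hij.symm, div_mul_eq_mul_div]
  | add p q hp hq => simp only [map_add, hp, hq]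

theorem exists_grad_eq_of_curl_eq_zero {f : Vec} (hf : curl f = 0) : ∃ p, grad p = f := by
  have closed : pderiv 0 (f 1) = pderiv 1 (f 0) := sub_eq_zero.1 hf
  have pderiv_remainder : pderiv 0 (f 1 - pderiv 1 (antideriv 0 (f 0))) = 0 := by
    rw [pderiv_antideriv_comm (by decide), map_sub, pderiv_antideriv, closed, sub_self]
  refine ⟨antideriv 0 (f 0) + antideriv 1 (f 1 - pderiv 1 (antideriv 0 (f 0))), funext fun i => ?_⟩
  rw [grad_apply, map_add]
  match i with
  | 0 =>
    rw [pderiv_antideriv, pderiv_antideriv_comm (by decide), pderiv_remainder, map_zero, add_zero]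
  | 1 => rw [pderiv_antideriv, add_sub_cancel]

theorem eq_C_of_forall_pderiv_eq_zero {σ R : Type*} [CommSemiring R] [NoZeroDivisors R] [CharZero R]
    {p : MvPolynomial σ R} (hp : ∀ i, pderiv i p = 0) : p = C (coeff 0 p) := by
  classical
  ext s
  rw [coeff_C]
  split_ifs with hs
  · rw [hs]
  · obtain ⟨i, hi⟩ : ∃ i, s i ≠ 0 := by
      by_contra! h
      exact hs (Finsupp.ext fun i => (h i).symm)
    have sub_add_single : s - Finsupp.single i 1 + Finsupp.single i 1 = s :=
      tsub_add_cancel_of_le (Finsupp.single_le_iff.2 (Nat.one_le_iff_ne_zero.2 hi))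
    have coeff_eq := congrArg (coeff (s - Finsupp.single i 1)) (hp i)
    rw [coeff_pderiv, sub_add_single, coeff_zero] at coeff_eq
    exact (mul_eq_zero.1 coeff_eq).resolve_right (Nat.cast_add_one_ne_zero _)

theorem grad_C (a : ℂ) : grad (C a) = 0 :=
  funext fun _ => pderiv_C

theorem disjoint_vanishing_ker_grad : Disjoint vanishing (LinearMap.ker grad) := by
  refine Submodule.disjoint_def.2 fun p hp hgrad => ?_
  have eq_C := eq_C_of_forall_pderiv_eq_zero (congrFun (LinearMap.mem_ker.1 hgrad))
  have eval_eq_zero := hp 1 0 (by norm_num)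
  rw [eq_C, eval_C] at eval_eq_zero
  rw [eq_C, eval_eq_zero, C_0]

theorem boundaryCoeff_C (m : ℤ) (c : ℂ) : boundaryCoeff m (C c) = if m = 0 then c else 0 := by
  have h := boundaryCoeff_aeval_rsq_mul_harm m 0 (Polynomial.C c)
  rwa [harm_zero, mul_one, Polynomial.aeval_C, Polynomial.eval_C, algebraMap_eq,
    if_congr eq_comm rfl rfl] at h

theorem boundaryCoeff_rsq (m : ℤ) : boundaryCoeff m rsq = if m = 0 then 1 else 0 := by
  have h := boundaryCoeff_aeval_rsq_mul_harm m 0 Polynomial.X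
  rwa [harm_zero, mul_one, Polynomial.aeval_X, Polynomial.eval_X, if_congr eq_comm rfl rfl] at h

theorem tangent_dotProduct_grad_aeval_rsq_mul_harm (m : ℤ) (p : Polynomial ℂ) :
    tangent ⬝ᵥ grad (Polynomial.aeval rsq p * harm m) =
      (Complex.I * m) • (Polynomial.aeval rsq p * harm m) := by
  rw [grad_aeval_rsq_mul_harm, dotProduct_add, dotProduct_smul, dotProduct_smul,
    tangent_dotProduct_radial, smul_zero, zero_add]
  rcases eq_or_ne m 0 with rfl | hm
  · simp
  · have natAbs_mul_isgn : (m.natAbs : ℂ) * isgn m = Complex.I * m := by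
      rw [isgn, mul_left_comm, ← Int.cast_natCast, ← Int.cast_mul, mul_comm (m.natAbs : ℤ),
        Int.sign_mul_natAbs]
    rw [tangent_dotProduct_vharm hm, ← natAbs_mul_isgn, smul_eq_C_mul, C_mul, map_natCast,
      smul_eq_mul]
    ring

theorem boundaryCoeff_tangent_dotProduct_grad (m : ℤ) (p : Scal) :
    boundaryCoeff m (tangent ⬝ᵥ grad p) = Complex.I * m * boundaryCoeff m p := by
  obtain ⟨f, rfl⟩ := modeEquiv.surjective p
  induction f using Finsupp.induction_linear with
  | zero => simp only [map_zero, dotProduct_zero, mul_zero]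
  | add f g hf hg => simp only [map_add, dotProduct_add, mul_add, hf, hg]
  | single n q =>
    rw [modeEquiv_single, tangent_dotProduct_grad_aeval_rsq_mul_harm, map_smul, smul_eq_mul,
      boundaryCoeff_aeval_rsq_mul_harm]
    split_ifs with h
    · rw [h]
    · rw [mul_zero, mul_zero]

theorem sub_C_mem_vanishing {p : Scal} (hp : tangent ⬝ᵥ grad p ∈ vanishing) :
    p - C (boundaryCoeff 0 p) ∈ vanishing := by
  rw [mem_vanishing_iff_boundaryCoeff] at hp ⊢
  intro m
  rw [map_sub, boundaryCoeff_C]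
  split_ifs with hm
  · rw [hm, sub_self]
  · have coeff_eq := hp m
    rw [boundaryCoeff_tangent_dotProduct_grad] at coeff_eq
    rw [sub_zero]
    exact (mul_eq_zero.1 coeff_eq).resolve_left
      (mul_ne_zero Complex.I_ne_zero (Int.cast_ne_zero.2 hm))

theorem normal_inf_ker_curl : normal ⊓ LinearMap.ker curl = vanishing.map grad := by
  refine le_antisymm ?_ ?_
  · rintro f ⟨hf, hcurl⟩
    obtain ⟨p, rfl⟩ := exists_grad_eq_of_curl_eq_zero hcurl
    refine ⟨_, sub_C_mem_vanishing (mem_normal_iff.1 hf), ?_⟩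
    rw [map_sub, grad_C, sub_zero]
  · rintro _ ⟨p, hp, rfl⟩
    refine ⟨mem_normal_iff.2 (mem_vanishing_iff_boundaryCoeff.2 fun m => ?_), curl_grad p⟩
    rw [boundaryCoeff_tangent_dotProduct_grad, mem_vanishing_iff_boundaryCoeff.1 hp, mul_zero]

/- If `curl f = c`, then `f - (c / 2) • tangent` is a gradient `∇ p`. The angular derivative of `p`
has no mean over the circle, and hence agrees with `-c / 2` there only if `c = 0`. -/
theorem eq_zero_of_curl_eq_C {f : Vec} (hf : f ∈ normal) {c : ℂ} (hc : curl f = C c) : c = 0 := by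
  obtain ⟨p, hp⟩ := exists_grad_eq_of_curl_eq_zero (f := f - (c / 2) • tangent) (by
    rw [map_sub, map_smul, hc, curl_tangent, smul_eq_C_mul, ← map_ofNat C 2, ← C_mul,
      div_mul_cancel₀ _ two_ne_zero, sub_self])
  have mean_eq := boundaryCoeff_tangent_dotProduct_grad 0 p
  rw [hp, dotProduct_sub, dotProduct_smul, tangent_dotProduct_tangent, map_sub, map_smul,
    mem_vanishing_iff_boundaryCoeff.1 (mem_normal_iff.1 hf), boundaryCoeff_rsq, if_pos rfl,
    Int.cast_zero, mul_zero, zero_mul, zero_sub, neg_eq_zero, smul_eq_mul, mul_one] at mean_eq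
  exact (div_eq_zero_iff.1 mean_eq).resolve_right two_ne_zero

theorem disjoint_map_curl_normal_range_algebraMap :
    Disjoint (normal.map curl) (LinearMap.range (Algebra.linearMap ℂ Scal)) := by
  rw [Submodule.disjoint_def]
  rintro _ ⟨f, hf, rfl⟩ ⟨c, hc⟩
  rw [← hc, eq_zero_of_curl_eq_C (c := c) hf hc.symm, map_zero]

end Exactness

section LinearAlgebra

variable {R M N ι κ : Type*} [Ring R] [AddCommGroup M] [Module R M] [AddCommGroup N] [Module R N]

theorem iSupIndep_span_image_fiber [Nontrivial R] {v : ι → M} (hv : LinearIndependent R v)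
    (φ : ι → κ) : iSupIndep fun k => Submodule.span R (v '' (φ ⁻¹' {k})) := by
  intro k
  have others_le : ⨆ l, ⨆ _ : l ≠ k, Submodule.span R (v '' (φ ⁻¹' {l})) ≤
      Submodule.span R (v '' (φ ⁻¹' {k})ᶜ) := by
    refine iSup₂_le fun l hl => Submodule.span_mono (Set.image_mono ?_)
    rintro i rfl
    exact hl
  exact (hv.disjoint_span_image disjoint_compl_right).mono_right others_le

theorem iSup_span_image_fiber (v : ι → M) (φ : ι → κ) :
    ⨆ k, Submodule.span R (v '' (φ ⁻¹' {k})) = Submodule.span R (Set.range v) := by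
  rw [← Submodule.span_iUnion, ← Set.image_iUnion, ← Set.preimage_iUnion, Set.iUnion_of_singleton,
    Set.preimage_univ, Set.image_univ]

theorem linearIndependent_sumElim_of_map {v : ι → M} {w : κ → M} (f : M →ₗ[R] N)
    (hv : LinearIndependent R v) (hvf : ∀ i, f (v i) = 0) (hw : LinearIndependent R (f ∘ w)) :
    LinearIndependent R (Sum.elim v w) := by
  have span_le_ker : Submodule.span R (Set.range v) ≤ LinearMap.ker f :=
    Submodule.span_le.2 (Set.range_subset_iff.2 hvf)
  exact hv.sum_type hw.of_comp ((Submodule.range_ker_disjoint hw).symm.mono_left span_le_ker)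

end LinearAlgebra

section Subcomplexes

theorem isExactSubcomplex_of_inf_ker_eq {A : Submodule ℂ Scal} {B : Submodule ℂ Vec}
    (hA : Disjoint A (LinearMap.ker grad)) (hB : B ⊓ LinearMap.ker curl = A.map grad) :
    IsExactSubcomplex A B (B.map curl) := by
  have grad_mem (u) (hu : u ∈ A) : grad u ∈ B :=
    (hB.ge (Submodule.mem_map_of_mem hu)).1
  refine ⟨grad_mem, fun f hf => Submodule.mem_map_of_mem hf, ?_, ?_, ?_⟩
  · rw [← LinearMap.ker_eq_bot, LinearMap.ker_restrict]
    exact Submodule.disjoint_iff_comap_eq_bot.1 hA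
  · intro f
    constructor
    · intro curl_eq_zero
      obtain ⟨p, hp, grad_eq⟩ := hB.le ⟨f.2, congrArg Subtype.val curl_eq_zero⟩
      exact ⟨⟨p, hp⟩, Subtype.ext grad_eq⟩
    · rintro ⟨p, rfl⟩
      exact Subtype.ext (curl_grad p)
  · rintro ⟨_, f, hf, rfl⟩
    exact ⟨⟨f, hf⟩, rfl⟩

theorem isExactSubcomplex_sup_span {A : Submodule ℂ Scal} (hA : A ≤ vanishing) {u : Vec}
    (hu : curl u ≠ 0) :
    IsExactSubcomplex A (A.map grad ⊔ Submodule.span ℂ {u}) (Submodule.span ℂ {curl u}) := by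
  have map_grad_le : A.map grad ≤ LinearMap.ker curl := by
    rintro _ ⟨p, -, rfl⟩
    exact curl_grad p
  have inf_ker : (A.map grad ⊔ Submodule.span ℂ {u}) ⊓ LinearMap.ker curl = A.map grad := by
    rw [sup_inf_assoc_of_le _ map_grad_le,
      (Submodule.disjoint_span_singleton_of_notMem hu).symm.eq_bot, sup_bot_eq]
  have map_curl : (A.map grad ⊔ Submodule.span ℂ {u}).map curl = Submodule.span ℂ {curl u} := by
    rw [Submodule.map_sup, LinearMap.le_ker_iff_map.1 map_grad_le, bot_sup_eq, Submodule.map_span,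
      Set.image_singleton]
  exact map_curl ▸
    isExactSubcomplex_of_inf_ker_eq (disjoint_vanishing_ker_grad.mono_left hA) inf_ker

theorem wzernike_mem_vanishing (m : ℤ) (j : ℕ) : wzernike m j ∈ vanishing :=
  span_wzernike ▸ Submodule.subset_span ⟨(m, j), rfl⟩

theorem zernike_ne_zero (m : ℤ) (j : ℕ) : zernike m j ≠ 0 :=
  linearIndependent_zernike.ne_zero (m, j)

theorem neg_one_div_cast_succ_ne_zero (j : ℕ) : -(1 / ((j : ℂ) + 1)) ≠ 0 :=
  neg_ne_zero.2 (one_div_ne_zero j.cast_add_one_ne_zero)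

theorem span_nPlus_succ (m : ℤ) (j : ℕ) :
    Submodule.span ℂ {nPlus m (j + 1)} = (Submodule.span ℂ {wzernike m j}).map grad := by
  rw [nPlus_succ, Submodule.map_span, Set.image_singleton,
    Submodule.span_singleton_smul_eq (neg_one_div_cast_succ_ne_zero j).isUnit]

theorem span_curl_nMinus {m : ℤ} {j : ℕ} (h : (m, j) ≠ (0, 0)) :
    Submodule.span ℂ {curl (nMinus m j)} = Submodule.span ℂ {zernike m j} := by
  rw [curl_nMinus h, Submodule.span_singleton_smul_eq (curlCoeff_ne_zero h).isUnit]

theorem curl_nMinus_ne_zero {m : ℤ} {j : ℕ} (h : (m, j) ≠ (0, 0)) : curl (nMinus m j) ≠ 0 :=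
  curl_nMinus h ▸ smul_ne_zero (curlCoeff_ne_zero h) (zernike_ne_zero m j)

theorem isExactSubcomplex_main (m : ℤ) (j : ℕ) :
    IsExactSubcomplex (Submodule.span ℂ {wzernike m j})
      (Submodule.span ℂ {nPlus m (j + 1), nMinus m (j + 1)})
      (Submodule.span ℂ {zernike m (j + 1)}) := by
  have h : (m, j + 1) ≠ (0, 0) := by simp
  rw [Submodule.span_insert, span_nPlus_succ, ← span_curl_nMinus h]
  exact isExactSubcomplex_sup_span
    ((Submodule.span_singleton_le_iff_mem _ _).2 (wzernike_mem_vanishing m j))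
    (curl_nMinus_ne_zero h)

theorem isExactSubcomplex_extra {m : ℤ} (hm : m ≠ 0) :
    IsExactSubcomplex ⊥ (Submodule.span ℂ {nMinus m 0}) (Submodule.span ℂ {zernike m 0}) := by
  have h : (m, 0) ≠ (0, 0) := by simpa using hm
  rw [← span_curl_nMinus h, ← bot_sup_eq (Submodule.span ℂ {nMinus m 0}),
    ← Submodule.map_bot grad]
  exact isExactSubcomplex_sup_span bot_le (curl_nMinus_ne_zero h)

end Subcomplexes

section Bases

theorem span_zernike_zero_zero : Submodule.span ℂ {zernike 0 0} =
    LinearMap.range (Algebra.linearMap ℂ Scal) := by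
  have zernike_zero_zero : zernike 0 0 = 1 := by
    simp [zernike, zernikeGen, harm, sjacobi_eq_sum]
  rw [zernike_zero_zero, ← Submodule.one_eq_span, Submodule.one_eq_range]

theorem linearIndependent_nPlus_succ :
    LinearIndependent ℂ fun p : ℤ × ℕ => nPlus p.1 (p.2 + 1) := by
  have grad_wzernike_indep := linearIndependent_wzernike.map
    (span_wzernike ▸ disjoint_vanishing_ker_grad)
  rw [funext fun p : ℤ × ℕ => nPlus_succ p.1 p.2]
  exact grad_wzernike_indep.units_smul fun p => .mk0 _ (neg_one_div_cast_succ_ne_zero p.2)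

theorem linearIndependent_curl_nMinus :
    LinearIndependent ℂ fun p : {p : ℤ × ℕ // p ≠ (0, 0)} => curl (nMinus p.1.1 p.1.2) := by
  rw [funext fun p : {p : ℤ × ℕ // p ≠ (0, 0)} => curl_nMinus p.2]
  exact (linearIndependent_zernike.comp _ Subtype.val_injective).units_smul
    fun p => .mk0 _ (curlCoeff_ne_zero p.2)

theorem linearIndependent_nFamily : LinearIndependent ℂ nFamily :=
  linearIndependent_sumElim_of_map curl linearIndependent_nPlus_succ
    (fun p => curl_nPlus_succ p.1 p.2) linearIndependent_curl_nMinus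

theorem span_nFamily_le_normal : Submodule.span ℂ (Set.range nFamily) ≤ normal := by
  refine Submodule.span_le.2 ?_
  rintro _ ⟨p | p, rfl⟩
  · exact nPlus_mem_normal _ _
  · exact nMinus_mem_normal _ _

theorem map_grad_vanishing_le_span_nFamily :
    vanishing.map grad ≤ Submodule.span ℂ (Set.range nFamily) := by
  rw [← span_wzernike, Submodule.span_range_eq_iSup, Submodule.map_iSup]
  refine iSup_le fun p => ?_
  rw [← span_nPlus_succ, Submodule.span_singleton_le_iff_mem]
  exact Submodule.subset_span ⟨.inl p, rfl⟩

theorem map_curl_span_nFamily_sup_span_zernike :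
    (Submodule.span ℂ (Set.range nFamily)).map curl ⊔ Submodule.span ℂ {zernike 0 0} = ⊤ := by
  rw [eq_top_iff, ← span_zernike, Submodule.span_range_eq_iSup]
  refine iSup_le fun ⟨m, j⟩ => ?_
  obtain h | h := eq_or_ne (m, j) (0, 0)
  · obtain ⟨rfl, rfl⟩ := Prod.mk.inj h
    exact le_sup_right
  · rw [← span_curl_nMinus h, Submodule.span_singleton_le_iff_mem]
    exact Submodule.mem_sup_left
      (Submodule.mem_map_of_mem (Submodule.subset_span ⟨.inr ⟨(m, j), h⟩, rfl⟩))

theorem isCompl_map_curl_normal :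
    IsCompl (normal.map curl) (Submodule.span ℂ {zernike 0 0}) := by
  refine ⟨span_zernike_zero_zero ▸ disjoint_map_curl_normal_range_algebraMap, ?_⟩
  rw [codisjoint_iff_le_sup, ← map_curl_span_nFamily_sup_span_zernike]
  exact sup_le_sup_right (Submodule.map_mono span_nFamily_le_normal) _

/- Two nested submodules with the same kernel and the same image under `curl` coincide. -/
theorem span_nFamily : Submodule.span ℂ (Set.range nFamily) = normal := by
  have map_curl_eq : (Submodule.span ℂ (Set.range nFamily)).map curl = normal.map curl := by
    refine eq_of_le_of_inf_le_of_sup_le (z := Submodule.span ℂ {zernike 0 0})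
      (Submodule.map_mono span_nFamily_le_normal) ?_ ?_
    · exact isCompl_map_curl_normal.inf_eq_bot.trans_le bot_le
    · exact map_curl_span_nFamily_sup_span_zernike ▸ le_top
  refine eq_of_le_of_inf_le_of_sup_le (z := LinearMap.ker curl) span_nFamily_le_normal ?_ ?_
  · rw [normal_inf_ker_curl]
    exact le_inf map_grad_vanishing_le_span_nFamily
      (normal_inf_ker_curl ▸ inf_le_right)
  · rw [← Submodule.comap_map_eq, ← Submodule.comap_map_eq, map_curl_eq]

end Bases

section Pieces

/-- The label of the sub-complex containing `n_{mj}^±`. -/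
def nLabel : (ℤ × ℕ) ⊕ {p : ℤ × ℕ // p ≠ (0, 0)} → Piece
  | .inl (m, j) => .main m j
  | .inr ⟨(m, 0), h⟩ => .extra m fun hm => h (by rw [hm])
  | .inr ⟨(m, j + 1), _⟩ => .main m j

/-- The label of the sub-complex containing `z_{mj}`. -/
def zLabel : ℤ × ℕ → Piece
  | (m, 0) => if h : m = 0 then .const else .extra m h
  | (m, j + 1) => .main m j

theorem piece0_eq (k : Piece) : piece0 k =
    Submodule.span ℂ ((fun p : ℤ × ℕ => wzernike p.1 p.2) ''
      ((fun p : ℤ × ℕ => Piece.main p.1 p.2) ⁻¹' {k})) := by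
  cases k with
  | main m j =>
    have fiber : (fun p : ℤ × ℕ => Piece.main p.1 p.2) ⁻¹' {.main m j} = {(m, j)} := by
      ext; simp [Prod.ext_iff]
    rw [fiber, Set.image_singleton, piece0]
  | extra m hm =>
    have fiber : (fun p : ℤ × ℕ => Piece.main p.1 p.2) ⁻¹' {.extra m hm} = ∅ := by ext; simp
    rw [fiber, Set.image_empty, Submodule.span_empty, piece0]
  | const =>
    have fiber : (fun p : ℤ × ℕ => Piece.main p.1 p.2) ⁻¹' {.const} = ∅ := by ext; simp
    rw [fiber, Set.image_empty, Submodule.span_empty, piece0]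

theorem piece1_eq (k : Piece) :
    piece1 k = Submodule.span ℂ (nFamily '' (nLabel ⁻¹' {k})) := by
  cases k with
  | main m j =>
    have fiber : nLabel ⁻¹' {.main m j} = {.inl (m, j), .inr ⟨(m, j + 1), by simp⟩} := by
      ext (⟨m', j'⟩ | ⟨⟨m', _ | j'⟩, h⟩) <;> simp [nLabel]
    rw [fiber, Set.image_pair]
    rfl
  | extra m hm =>
    have fiber : nLabel ⁻¹' {.extra m hm} = {.inr ⟨(m, 0), by simpa using hm⟩} := by
      ext (⟨m', j'⟩ | ⟨⟨m', _ | j'⟩, h⟩) <;> simp [nLabel]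
    rw [fiber, Set.image_singleton]
    rfl
  | const =>
    have fiber : nLabel ⁻¹' {.const} = ∅ := by
      ext (⟨m', j'⟩ | ⟨⟨m', _ | j'⟩, h⟩) <;> simp [nLabel]
    rw [fiber, Set.image_empty, Submodule.span_empty, piece1]

theorem piece2_eq (k : Piece) :
    piece2 k = Submodule.span ℂ ((fun p : ℤ × ℕ => zernike p.1 p.2) '' (zLabel ⁻¹' {k})) := by
  cases k with
  | main m j =>
    have fiber : zLabel ⁻¹' {.main m j} = {(m, j + 1)} := by
      ext ⟨m', _ | j'⟩
      · by_cases h : m' = 0 <;> simp [zLabel, h]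
      · simp [zLabel]
    rw [fiber, Set.image_singleton, piece2]
  | extra m hm =>
    have fiber : zLabel ⁻¹' {.extra m hm} = {(m, 0)} := by
      ext ⟨m', _ | j'⟩
      · by_cases h : m' = 0
        · simp [zLabel, h, hm.symm]
        · simp [zLabel, h]
      · simp [zLabel]
    rw [fiber, Set.image_singleton, piece2]
  | const =>
    have fiber : zLabel ⁻¹' {.const} = {(0, 0)} := by
      ext ⟨m', _ | j'⟩ <;> simp [zLabel]
    rw [fiber, Set.image_singleton, piece2]

end Pieces

end

end DeRhamDisk

theorem mainTheorem3 :
    -- for each mode `m` and each `j ≥ 0` an exact complex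
    (∀ (m : ℤ) (j : ℕ), DeRhamDisk.IsExactSubcomplex
      (Submodule.span ℂ {DeRhamDisk.wzernike m j})
      (Submodule.span ℂ {DeRhamDisk.nPlus m (j + 1), DeRhamDisk.nMinus m (j + 1)})
      (Submodule.span ℂ {DeRhamDisk.zernike m (j + 1)})) ∧
    -- the additional exact complexes for `m ≠ 0`
    (∀ m : ℤ, m ≠ 0 → DeRhamDisk.IsExactSubcomplex
      ⊥
      (Submodule.span ℂ {DeRhamDisk.nMinus m 0})
      (Submodule.span ℂ {DeRhamDisk.zernike m 0})) ∧
    -- the generators are bases of the three spaces of the polynomial de Rham complex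
    ((LinearIndependent ℂ (fun p : ℤ × ℕ => DeRhamDisk.wzernike p.1 p.2) ∧
        Submodule.span ℂ (Set.range fun p : ℤ × ℕ => DeRhamDisk.wzernike p.1 p.2) =
          DeRhamDisk.vanishing) ∧
      (LinearIndependent ℂ DeRhamDisk.nFamily ∧
        Submodule.span ℂ (Set.range DeRhamDisk.nFamily) = DeRhamDisk.normal) ∧
      (LinearIndependent ℂ (fun p : ℤ × ℕ => DeRhamDisk.zernike p.1 p.2) ∧
        Submodule.span ℂ (Set.range fun p : ℤ × ℕ => DeRhamDisk.zernike p.1 p.2) = ⊤)) ∧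
    -- the polynomial de Rham complex is the direct sum of these complexes and the constants
    ((iSupIndep DeRhamDisk.piece0 ∧ ⨆ p, DeRhamDisk.piece0 p = DeRhamDisk.vanishing) ∧
      (iSupIndep DeRhamDisk.piece1 ∧ ⨆ p, DeRhamDisk.piece1 p = DeRhamDisk.normal) ∧
      (iSupIndep DeRhamDisk.piece2 ∧ ⨆ p, DeRhamDisk.piece2 p = ⊤)) ∧
    -- `z_{00}` spans the constants, which are exactly what the range of the curl misses
    (Submodule.span ℂ {DeRhamDisk.zernike 0 0} =
        LinearMap.range (Algebra.linearMap ℂ DeRhamDisk.Scal) ∧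
      IsCompl (Submodule.map DeRhamDisk.curl DeRhamDisk.normal)
        (Submodule.span ℂ {DeRhamDisk.zernike 0 0})) := by
  open DeRhamDisk in
  refine ⟨isExactSubcomplex_main, fun m hm => isExactSubcomplex_extra hm,
    ⟨⟨linearIndependent_wzernike, span_wzernike⟩, ⟨linearIndependent_nFamily, span_nFamily⟩,
      linearIndependent_zernike, span_zernike⟩, ⟨⟨?_, ?_⟩, ⟨?_, ?_⟩, ?_, ?_⟩,
    span_zernike_zero_zero, isCompl_map_curl_normal⟩
  · rw [funext piece0_eq]
    exact iSupIndep_span_image_fiber linearIndependent_wzernike _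
  · rw [funext piece0_eq, iSup_span_image_fiber, span_wzernike]
  · rw [funext piece1_eq]
    exact iSupIndep_span_image_fiber linearIndependent_nFamily _
  · rw [funext piece1_eq, iSup_span_image_fiber, span_nFamily]
  · rw [funext piece2_eq]
    exact iSupIndep_span_image_fiber linearIndependent_zernike _
  · rw [funext piece2_eq, iSup_span_image_fiber, span_zernike]
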